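/- Let $d\ge 1$ and $m\ge 0$ be integers, let $\Omega_i=[a_i,b_i]$ with $a_i<b_i$ be bounded closed intervals in $\mathbb R$ for $i=1,\dots,d$, and let $\Omega=\Omega_1\times\cdots\times\Omega_d$. Let $H^m(\Omega)$ be the Sobolev space of real functions whose weak derivatives $D^\alpha f$ of all orders $|\alpha|\le m$ on the interior of $\Omega$ lie in $L^2$, with the norm $\|f\|_{H^m(\Omega)}=\big(\sum_{|\alpha|\le m}\|D^\alpha f\|_{L^2(\Omega)}^2\big)^{1/2}$. For each $i$ let an activation function $\sigma_i\in C^m(\mathbb R)$ that is not a polynomial be given. Then for every $f\in H^m(\Omega)$ and every $\varepsilon>0$ there are a positive integer $p$ and, for each $i=1,\dots,d$, a fully connected neural network $\Phi_i(\cdot\,;\theta_i)=(\phi_{i,1}(\cdot\,;\theta_i),\dots,\phi_{i,p}(\cdot\,;\theta_i)):\mathbb R\to\mathbb R^p$ with at least one hidden layer, with activation function $\sigma_i$ in its hidden layers and with an affine output layer (the number of hidden layers, their widths, and the weights and biases $\theta_i$ being free), such that the tensor neural network $$\Psi(x;\theta)=\sum_{j=1}^p\prod_{i=1}^d\phi_{i,j}(x_i;\theta_i)$$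 belongs to $H^m(\Omega)$ and satisfies $$\|f-\Psi(\cdot\,;\theta)\|_{H^m(\Omega)}<\varepsilon .$$ -/

import Mathlib

open scoped ContDiff

noncomputable section

namespace TensorNN

/-! ### Sobolev spaces `H^m` on open subsets of `ℝ^d`

Only scalar functions are measured, and only in `L²`, so the choice of the norm on `Fin d → ℝ`
plays no role; `volume` is the Lebesgue measure. -/

/-- The classical partial derivative `∂φ/∂x_i`. -/
def partialDeriv {d : ℕ} (i : Fin d) (φ : (Fin d → ℝ) → ℝ) : (Fin d → ℝ) → ℝ :=
  fun x => fderiv ℝ φ x (Pi.single i 1)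

/-- The classical derivative `D^α φ = ∂_1^{α_1} ⋯ ∂_d^{α_d} φ` for a multi-index `α`. -/
def multiDeriv {d : ℕ} (α : Fin d → ℕ) (φ : (Fin d → ℝ) → ℝ) : (Fin d → ℝ) → ℝ :=
  (List.finRange d).foldr (fun i ψ => (partialDeriv i)^[α i] ψ) φ

/-- Test functions on `U`: smooth, with compact support contained in `U`. -/
def IsTestFunction {d : ℕ} (U : Set (Fin d → ℝ)) (φ : (Fin d → ℝ) → ℝ) : Prop :=
  ContDiff ℝ ∞ φ ∧ HasCompactSupport φ ∧ tsupport φ ⊆ U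

/-- `g` is a weak derivative `D^α f` on the open set `U`. -/
def IsWeakDeriv {d : ℕ} (U : Set (Fin d → ℝ)) (α : Fin d → ℕ)
    (f g : (Fin d → ℝ) → ℝ) : Prop :=
  MeasureTheory.LocallyIntegrableOn f U ∧ MeasureTheory.LocallyIntegrableOn g U ∧
    ∀ φ : (Fin d → ℝ) → ℝ, IsTestFunction U φ →
      ∫ x in U, f x * multiDeriv α φ x = (-1) ^ (∑ i, α i) * ∫ x in U, g x * φ x

/-- `g` is a square-integrable weak derivative `D^α f` on `U`. -/
def IsL2WeakDeriv {d : ℕ} (U : Set (Fin d → ℝ)) (α : Fin d → ℕ)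
    (f g : (Fin d → ℝ) → ℝ) : Prop :=
  MeasureTheory.MemLp g 2 (MeasureTheory.volume.restrict U) ∧ IsWeakDeriv U α f g

/-- The multi-indices `α` with `|α| ≤ m`. -/
def multiIndices (d m : ℕ) : Finset (Fin d → ℕ) :=
  (Fintype.piFinset fun _ : Fin d => Finset.range (m + 1)).filter fun α => ∑ i, α i ≤ m

theorem mem_multiIndices {d m : ℕ} {α : Fin d → ℕ} :
    α ∈ multiIndices d m ↔ ∑ i, α i ≤ m := by
  simp only [multiIndices, Finset.mem_filter, Fintype.mem_piFinset, Finset.mem_range,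
    and_iff_right_iff_imp]
  intro h i
  have := Finset.single_le_sum (f := α) (fun _ _ => Nat.zero_le _) (Finset.mem_univ i)
  omega

/-- `f ∈ H^m(U)`: `f` and all its weak derivatives of order at most `m` are in `L²(U)`.
Only the values of `f` on `U` matter. -/
def MemSobolev {d : ℕ} (m : ℕ) (U : Set (Fin d → ℝ)) (f : (Fin d → ℝ) → ℝ) : Prop :=
  MeasureTheory.MemLp f 2 (MeasureTheory.volume.restrict U) ∧
    ∀ α ∈ multiIndices d m, ∃ g, IsL2WeakDeriv U α f g

open Classical in
/-- The weak derivative `D^α f` on `U` (unique almost everywhere), if there is one in `L²(U)`. -/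
def weakDeriv {d : ℕ} (U : Set (Fin d → ℝ)) (α : Fin d → ℕ) (f : (Fin d → ℝ) → ℝ) :
    (Fin d → ℝ) → ℝ :=
  if h : ∃ g, IsL2WeakDeriv U α f g then h.choose else 0

/-- The norm `‖f‖_{H^m(U)} = (∑_{|α| ≤ m} ‖D^α f‖²_{L²(U)})^{1/2}`, meaningful for
`f ∈ H^m(U)`. -/
def sobolevNorm {d : ℕ} (m : ℕ) (U : Set (Fin d → ℝ)) (f : (Fin d → ℝ) → ℝ) : ℝ :=
  Real.sqrt (∑ α ∈ multiIndices d m, ∫ x in U, weakDeriv U α f x ^ 2)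

/-! ### Tensor neural networks -/

/-- Parameters (weights and biases) of a fully connected network with `n` inputs and `p` outputs,
with any number of hidden layers of any widths. -/
inductive FNN : ℕ → ℕ → Type
  | output {n p : ℕ} (W : Matrix (Fin p) (Fin n) ℝ) (c : Fin p → ℝ) : FNN n p
  | hidden {n k p : ℕ} (W : Matrix (Fin k) (Fin n) ℝ) (c : Fin k → ℝ) (N : FNN k p) : FNN n p

/-- The number of hidden layers. -/
def FNN.depth : {n p : ℕ} → FNN n p → ℕ
  | _, _, .output _ _ => 0
  | _, _, .hidden _ _ N => N.depth + 1

/-- The function computed by the network: every hidden layer is an affine map followed by the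
activation function `σ` in each coordinate, and the output layer is affine. -/
def FNN.eval (σ : ℝ → ℝ) : {n p : ℕ} → FNN n p → (Fin n → ℝ) → Fin p → ℝ
  | _, _, .output W c, x => W.mulVec x + c
  | _, _, .hidden W c N, x => N.eval σ fun j => σ ((W.mulVec x + c) j)

/-- The tensor neural network `Ψ(x) = ∑_{j=1}^p ∏_{i=1}^d φ_{i,j}(x_i)`, where
`φ_i = (φ_{i,1}, …, φ_{i,p}) : ℝ → ℝ^p` is the subnetwork `Φ i` with activation `σ i`. -/
def tnn {d p : ℕ} (σ : Fin d → ℝ → ℝ) (Φ : Fin d → FNN 1 p) (x : Fin d → ℝ) : ℝ :=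
  ∑ j : Fin p, ∏ i : Fin d, (Φ i).eval (σ i) (fun _ => x i) j

end TensorNN

end

noncomputable section

namespace TensorNN

open MeasureTheory Filter Topology

/-! ### Uniform approximation of one-dimensional `C^m` functions -/

/-! One variable. Call the derivatives of order at most `m` on `[a, b]` the jet. The closed span of
the jets of `t ↦ σ (w t + c)` contains every `C^m` jet (`jet_mem_ridgeClosure`), by the argument of
Leshno, Lin, Pinkus and Schocken. A mollification `g` of `σ` is smooth, and the jets of its ridge
functions are Bochner integrals of jets of `σ`, hence stay in the closed span. As `σ` is not a
polynomial, for each `k` some `g` has a nonzero `k`-th derivative at some `c`; the rescaled Taylor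
remainders of `g (w t + c)` as `w → 0` then yield `t ^ k`. Polynomials are dense in `C^m [a, b]`.

Several variables. Forming products of factors is continuous for jets, so products of `C^m`
functions lie in the closed span of products of ridge functions
(`tensorJet_mem_tensorRidgeClosure`). Given `f` in `H^m` of the open box, shrink `x` towards the
centre `c` by a factor `r < 1` and mollify with a product kernel: `x ↦ ∫ f y * ∏ ψ (z_i - y_i) dy`,
`z = c + r (x - c)`. This is a Bochner integral of products of one-variable functions, so it lies in
the same closed span without any separate density theorem in `d` variables
(`exists_mem_tensorRidgeClosure_eq_mollify`). Shrinking keeps the kernel's support inside the box,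
so no extension of `f` is needed and derivatives pass to the weak derivatives of `f`.

The dilated mollifications converge in `L²` for every `|α| ≤ m`, by continuity of dilations and
translations on `L²` (`eventually_eLpNorm_mollify_dilate_sub_le`). Finally, finite sums of ridge
functions are networks with one hidden layer (`exists_fnn_eval_eq`). -/

theorem integral_mem_submodule {X E : Type*} [MeasurableSpace X] {μ : Measure X}
    [NormedAddCommGroup E] [NormedSpace ℝ E] [CompleteSpace E] (V : Submodule ℝ E)
    (hV : IsClosed (V : Set E)) {f : X → E} (hf : Integrable f μ) (hfV : ∀ x, f x ∈ V) :
    ∫ x, f x ∂μ ∈ V := by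
  have : IsClosed (V : Set E) := hV
  -- The quotient by a closed subspace is a normed space, and its projection commutes with the
  -- integral while annihilating the integrand.
  have h := (V.mkQL).integral_comp_comm hf
  have h0 : ∀ x, V.mkQL (f x) = 0 := fun x => (Submodule.Quotient.mk_eq_zero V).2 (hfV x)
  simp only [h0, integral_zero] at h
  exact (Submodule.Quotient.mk_eq_zero V).1 h.symm

/-- The derivatives of order at most `m` of a `C^m` function, restricted to `[a, b]`. -/
def jet (a b : ℝ) (m : ℕ) (v : ℝ → ℝ) (hv : ContDiff ℝ m v) :
    Fin (m + 1) → C(Set.Icc a b, ℝ) :=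
  fun j => ⟨fun t => iteratedDeriv j v t,
    (hv.continuous_iteratedDeriv j (by exact_mod_cast Nat.lt_succ_iff.1 j.2)).comp
      continuous_subtype_val⟩

@[simp] theorem jet_apply (a b : ℝ) (m : ℕ) (v : ℝ → ℝ) (hv : ContDiff ℝ m v) (j : Fin (m + 1))
    (t : Set.Icc a b) : jet a b m v hv j t = iteratedDeriv j v t := rfl

theorem contDiff_ridge {m : ℕ} {σ : ℝ → ℝ} (hσ : ContDiff ℝ m σ) (w c : ℝ) :
    ContDiff ℝ m fun t => σ (w * t + c) :=
  hσ.comp ((contDiff_const.mul contDiff_id).add contDiff_const)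

theorem iteratedDeriv_ridge {m j : ℕ} (hj : j ≤ m) {σ : ℝ → ℝ} (hσ : ContDiff ℝ m σ) (w c t : ℝ) :
    iteratedDeriv j (fun t => σ (w * t + c)) t = w ^ j * iteratedDeriv j σ (w * t + c) := by
  have h : ContDiff ℝ j fun s => σ (s + c) :=
    (hσ.of_le (by exact_mod_cast hj)).comp (contDiff_id.add contDiff_const)
  have := congrFun (iteratedDeriv_comp_const_mul h w) t
  rw [this, iteratedDeriv_comp_add_const]

theorem contDiff_iteratedDeriv {n : WithTop ℕ∞} {k j : ℕ} {v : ℝ → ℝ} (hv : ContDiff ℝ n v)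
    (h : ((k + j : ℕ) : WithTop ℕ∞) ≤ n) : ContDiff ℝ k (iteratedDeriv j v) := by
  rw [iteratedDeriv_eq_iterate]
  exact (hv.of_le h).iterate_deriv' k j

/-- The closed span of the jets of the ridge functions `t ↦ σ (w t + c)`. -/
def ridgeClosure (a b : ℝ) (m : ℕ) (σ : ℝ → ℝ) (hσ : ContDiff ℝ m σ) :
    Submodule ℝ (Fin (m + 1) → C(Set.Icc a b, ℝ)) :=
  (Submodule.span ℝ (Set.range fun p : ℝ × ℝ =>
    jet a b m (fun t => σ (p.1 * t + p.2)) (contDiff_ridge hσ p.1 p.2))).topologicalClosure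

theorem isClosed_ridgeClosure (a b : ℝ) (m : ℕ) (σ : ℝ → ℝ) (hσ : ContDiff ℝ m σ) :
    IsClosed (ridgeClosure a b m σ hσ : Set (Fin (m + 1) → C(Set.Icc a b, ℝ))) :=
  Submodule.isClosed_topologicalClosure _

theorem jet_ridge_mem (a b : ℝ) (m : ℕ) (σ : ℝ → ℝ) (hσ : ContDiff ℝ m σ) (w c : ℝ) :
    jet a b m (fun t => σ (w * t + c)) (contDiff_ridge hσ w c) ∈ ridgeClosure a b m σ hσ :=
  Submodule.le_topologicalClosure _ (Submodule.subset_span ⟨(w, c), rfl⟩)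

/-! ### Mollified ridge functions stay in the closed ridge span. -/

/-- Mollification of `σ` by `ψ`. -/
def mollify (ψ σ : ℝ → ℝ) (x : ℝ) : ℝ := ∫ y, ψ y * σ (x - y)

theorem mollify_eq_convolution (ψ σ : ℝ → ℝ) :
    mollify ψ σ = convolution ψ σ (ContinuousLinearMap.lsmul ℝ ℝ) volume := by
  ext x; simp [mollify, convolution]

theorem contDiff_mollify {ψ σ : ℝ → ℝ} (hψ : ContDiff ℝ ∞ ψ) (hψc : HasCompactSupport ψ)
    (hσ : Continuous σ) : ContDiff ℝ ∞ (mollify ψ σ) := by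
  rw [mollify_eq_convolution]
  exact hψc.contDiff_convolution_left _ hψ hσ.locallyIntegrable

theorem hasCompactSupport_iteratedDeriv {ψ : ℝ → ℝ} (hψc : HasCompactSupport ψ) (j : ℕ) :
    HasCompactSupport (iteratedDeriv j ψ) := by
  induction j with
  | zero => simpa using hψc
  | succ j ih => rw [iteratedDeriv_succ]; exact ih.deriv

theorem iteratedDeriv_mollify {ψ σ : ℝ → ℝ} (hψ : ContDiff ℝ ∞ ψ) (hψc : HasCompactSupport ψ)
    (hσ : Continuous σ) (j : ℕ) :
    iteratedDeriv j (mollify ψ σ) = mollify (iteratedDeriv j ψ) σ := by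
  induction j with
  | zero => simp
  | succ j ih =>
    rw [iteratedDeriv_succ, ih, iteratedDeriv_succ]
    ext x
    rw [mollify_eq_convolution, mollify_eq_convolution]
    refine ((hasCompactSupport_iteratedDeriv hψc j).hasDerivAt_convolution_left _ ?_
      hσ.locallyIntegrable x).deriv
    exact contDiff_iteratedDeriv hψ (by exact_mod_cast le_top)

theorem integrable_mul_comp_sub {ψ σ : ℝ → ℝ} (hψ : Continuous ψ) (hψc : HasCompactSupport ψ)
    (hσ : Continuous σ) (x : ℝ) : Integrable fun y => ψ y * σ (x - y) :=
  (hψ.mul (hσ.comp (continuous_const.sub continuous_id))).integrable_of_hasCompactSupport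
    hψc.mul_right

theorem mollify_deriv_left {ψ σ : ℝ → ℝ} (hψ : ContDiff ℝ 1 ψ) (hψc : HasCompactSupport ψ)
    (hσ : ContDiff ℝ 1 σ) : mollify (deriv ψ) σ = mollify ψ (deriv σ) := by
  ext x
  have hd : ∀ (u : ℝ → ℝ), ContDiff ℝ 1 u → ∀ y, HasDerivAt u (deriv u y) y := fun u hu y =>
    (hu.differentiable (by norm_num) y).hasDerivAt
  have hc : ∀ (u : ℝ → ℝ), ContDiff ℝ 1 u → Continuous (deriv u) := fun u hu =>
    hu.continuous_deriv le_rfl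
  have h := integral_mul_deriv_eq_deriv_mul_of_integrable (u := ψ) (u' := deriv ψ)
    (v := fun y => σ (x - y)) (v' := fun y => - deriv σ (x - y))
    (fun y _ => hd ψ hψ y)
    (fun y _ => by
      exact (hd σ hσ (x - y)).comp_const_sub x y)
    (by
      have := (integrable_mul_comp_sub hψ.continuous hψc (hc σ hσ) x).neg
      refine this.congr (ae_of_all _ fun y => ?_)
      simp)
    (integrable_mul_comp_sub (hc ψ hψ) hψc.deriv hσ.continuous x)
    (integrable_mul_comp_sub hψ.continuous hψc hσ.continuous x)
  simp only [mul_neg, integral_neg, neg_inj] at h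
  exact h.symm

/-- Integration by parts, one derivative at a time, with no boundary terms since `ψ` has compact
support. It expresses the jet of a mollification through the jet of `σ`. -/
theorem mollify_iteratedDeriv_left {m : ℕ} {σ : ℝ → ℝ} (hσ : ContDiff ℝ m σ) {j : ℕ} (hj : j ≤ m)
    {ψ : ℝ → ℝ} (hψ : ContDiff ℝ ∞ ψ) (hψc : HasCompactSupport ψ) :
    mollify (iteratedDeriv j ψ) σ = mollify ψ (iteratedDeriv j σ) := by
  induction j generalizing ψ with
  | zero => simp
  | succ j ih =>
    rw [iteratedDeriv_succ', ih (by omega) (contDiff_infty_iff_deriv.1 hψ).2 hψc.deriv,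
      mollify_deriv_left (hψ.of_le (by exact_mod_cast le_top)) hψc, ← iteratedDeriv_succ]
    exact contDiff_iteratedDeriv hσ (by exact_mod_cast (by omega : 1 + j ≤ m))

theorem continuous_jet_ridge (a b : ℝ) {m : ℕ} {σ : ℝ → ℝ} (hσ : ContDiff ℝ m σ) (w : ℝ) :
    Continuous fun c => jet a b m (fun t => σ (w * t + c)) (contDiff_ridge hσ w c) := by
  refine continuous_pi fun j => ContinuousMap.continuous_of_continuous_uncurry _ ?_
  have hj : (j : ℕ) ≤ m := Nat.lt_succ_iff.1 j.2
  simp only [jet_apply, iteratedDeriv_ridge hj hσ]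
  have := hσ.continuous_iteratedDeriv j (by exact_mod_cast hj)
  unfold Function.uncurry
  fun_prop

/-- The jet is the Bochner integral over `y` of `ψ y` times the jet of `t ↦ σ (w t + c - y)`, which
is checked by evaluating at each order and point. -/
theorem jet_mollify_ridge_mem (a b : ℝ) {m : ℕ} {σ : ℝ → ℝ} (hσ : ContDiff ℝ m σ) {ψ : ℝ → ℝ}
    (hψ : ContDiff ℝ ∞ ψ) (hψc : HasCompactSupport ψ) (hg : ContDiff ℝ m (mollify ψ σ)) (w c : ℝ) :
    jet a b m (fun t => mollify ψ σ (w * t + c)) (contDiff_ridge hg w c) ∈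
      ridgeClosure a b m σ hσ := by
  set e : ℝ → Fin (m + 1) → C(Set.Icc a b, ℝ) := fun y =>
    ψ y • jet a b m (fun t => σ (w * t + (c - y))) (contDiff_ridge hσ w (c - y)) with he
  have hle : ∀ j : Fin (m + 1), (j : ℕ) ≤ m := fun j => Nat.lt_succ_iff.1 j.2
  have hcont : Continuous e := hψ.continuous.smul
    ((continuous_jet_ridge a b hσ w).comp (continuous_const.sub continuous_id))
  have hint : Integrable e := hcont.integrable_of_hasCompactSupport hψc.smul_right
  have hmem := integral_mem_submodule (ridgeClosure a b m σ hσ) (isClosed_ridgeClosure a b m σ hσ)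
    hint fun y => Submodule.smul_mem _ _ (jet_ridge_mem a b m σ hσ w (c - y))
  convert hmem using 1
  ext j t
  have h := ((ContinuousMap.evalCLM ℝ t).comp
    (ContinuousLinearMap.proj (R := ℝ) (φ := fun _ : Fin (m + 1) => C(Set.Icc a b, ℝ)) j)).integral_comp_comm hint
  change _ = ((ContinuousMap.evalCLM ℝ t).comp
    (ContinuousLinearMap.proj (R := ℝ) (φ := fun _ : Fin (m + 1) => C(Set.Icc a b, ℝ)) j)) _
  rw [← h, jet_apply, iteratedDeriv_ridge (hle j) hg, iteratedDeriv_mollify hψ hψc hσ.continuous,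
    mollify_iteratedDeriv_left hσ (hle j) hψ hψc, mollify, ← integral_const_mul]
  refine integral_congr_ae (ae_of_all _ fun y => ?_)
  change _ = ψ y * iteratedDeriv j (fun t => σ (w * t + (c - y))) t
  rw [iteratedDeriv_ridge (hle j) hσ]
  ring_nf

/-! ### Where non-polynomiality enters. -/

theorem exists_eq_sum_pow_of_iteratedDeriv_eq_zero (k : ℕ) {g : ℝ → ℝ} (hg : ContDiff ℝ ∞ g)
    (h : ∀ t, iteratedDeriv k g t = 0) :
    ∃ c : ℕ → ℝ, ∀ t, g t = ∑ i ∈ Finset.range k, c i * t ^ i := by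
  induction k generalizing g with
  | zero => exact ⟨0, fun t => by simpa using h t⟩
  | succ k ih =>
    obtain ⟨hgd, hg'⟩ := contDiff_infty_iff_deriv.1 hg
    obtain ⟨c, hc⟩ := ih hg' fun t => by rw [← iteratedDeriv_succ']; exact h t
    refine ⟨fun i => if i = 0 then g 0 else c (i - 1) / i, fun t => ?_⟩
    have key : ∀ t, HasDerivAt (fun t => g t - ∑ i ∈ Finset.range k, c i / (i + 1) * t ^ (i + 1))
        0 t := by
      intro t
      have h1 := (hgd t).hasDerivAt.sub (HasDerivAt.fun_sum (u := Finset.range k) (fun i _ =>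
        (hasDerivAt_pow (i + 1) t).const_mul (c i / (i + 1))))
      refine h1.congr_deriv ?_
      rw [hc t, sub_eq_zero]
      refine Finset.sum_congr rfl fun i _ => ?_
      push_cast
      have : (i : ℝ) + 1 ≠ 0 := by positivity
      field_simp
    have h2 := is_const_of_deriv_eq_zero (fun t => (key t).differentiableAt)
      (fun t => (key t).deriv) t 0
    rw [Finset.sum_range_succ']
    simp only [ne_eq, Nat.add_eq_zero_iff, one_ne_zero, and_false, not_false_eq_true, zero_pow,
      mul_zero, Finset.sum_const_zero, sub_zero] at h2
    simp only [Nat.add_eq_zero_iff, one_ne_zero, and_false, if_false, Nat.add_sub_cancel,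
      if_true, pow_zero, mul_one, Nat.cast_add, Nat.cast_one]
    linarith

/-- Otherwise all mollifications are polynomials of degree less than the same `k`, hence equal to
their Lagrange interpolants at `k` fixed nodes. This identity survives the pointwise limit to `σ`.
Because `k` does not depend on `ψ`, no Baire argument is required. -/
theorem exists_iteratedDeriv_mollify_ne_zero {σ : ℝ → ℝ} (hσ : Continuous σ)
    (hpoly : ¬ ∃ P : Polynomial ℝ, ∀ t : ℝ, σ t = P.eval t) (k : ℕ) :
    ∃ ψ : ℝ → ℝ, ContDiff ℝ ∞ ψ ∧ HasCompactSupport ψ ∧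
      ∃ c, iteratedDeriv k (mollify ψ σ) c ≠ 0 := by
  by_contra! H
  apply hpoly
  let φ : ℕ → ContDiffBump (0 : ℝ) := fun n =>
    ⟨1 / (n + 1), 2 * (1 / (n + 1)), by positivity, by
      have : (0 : ℝ) < 1 / (n + 1) := by positivity
      linarith⟩
  have hlim : ∀ t, Tendsto (fun n => mollify ((φ n).normed volume) σ t) atTop (𝓝 (σ t)) := by
    intro t
    simp only [mollify_eq_convolution]
    refine ContDiffBump.convolution_tendsto_right_of_continuous ?_ hσ t
    simpa [φ] using (tendsto_one_div_add_atTop_nhds_zero_nat (𝕜 := ℝ)).const_mul 2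
  set x : ℕ → ℝ := fun i => i
  have hx : Set.InjOn x (Finset.range k) := fun i _ j _ h => by simpa [x] using h
  refine ⟨Lagrange.interpolate (Finset.range k) x (fun i => σ (x i)), fun t => ?_⟩
  refine tendsto_nhds_unique (hlim t) ?_
  have heq : ∀ n, mollify ((φ n).normed volume) σ t = ∑ i ∈ Finset.range k,
      mollify ((φ n).normed volume) σ (x i) * (Lagrange.basis (Finset.range k) x i).eval t := by
    intro n
    have h1 : ContDiff ℝ ∞ ((φ n).normed volume) := (φ n).contDiff_normed
    have h2 : HasCompactSupport ((φ n).normed volume) := (φ n).hasCompactSupport_normed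
    obtain ⟨c, hc⟩ := exists_eq_sum_pow_of_iteratedDeriv_eq_zero k
      (contDiff_mollify h1 h2 hσ) (H _ h1 h2)
    set P : Polynomial ℝ := ∑ i ∈ Finset.range k, Polynomial.C (c i) * Polynomial.X ^ i with hP
    have hPe : ∀ t, mollify ((φ n).normed volume) σ t = P.eval t := fun t => by
      rw [hc t, hP]; simp [Polynomial.eval_finsetSum]
    have hdeg : P.degree < (Finset.range k).card := by
      rw [Finset.card_range]
      refine (Polynomial.degree_sum_le _ _).trans_lt ?_
      rw [Finset.sup_lt_iff (by exact WithBot.bot_lt_coe k)]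
      intro i hi
      exact (Polynomial.degree_C_mul_X_pow_le i _).trans_lt
        (by exact_mod_cast Finset.mem_range.1 hi)
    have h3 := Lagrange.eq_interpolate hx hdeg
    simp only [hPe]
    conv_lhs => rw [h3]
    simp [Lagrange.interpolate_apply, Polynomial.eval_finsetSum]
  simp only [heq, Lagrange.interpolate_apply, Polynomial.eval_finsetSum, Polynomial.eval_mul,
    Polynomial.eval_C]
  exact tendsto_finsetSum _ fun i _ => (hlim (x i)).mul_const _

/-! ### Monomials as limits of rescaled Taylor remainders. -/

/-- A smooth function whose derivatives of order at most `k` vanish at `0` is `O(|τ|^(k+1))` there,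
and so on for its derivatives. -/
theorem exists_bound_of_flat {h : ℝ → ℝ} (hh : ContDiff ℝ ∞ h) {k : ℕ}
    (h0 : ∀ i ≤ k, iteratedDeriv i h 0 = 0) :
    ∃ M, 0 ≤ M ∧ ∀ n j, j + n = k + 1 → ∀ τ, |τ| ≤ 1 → |iteratedDeriv j h τ| ≤ M * |τ| ^ n := by
  obtain ⟨M, hM⟩ := (isCompact_Icc (a := (-1 : ℝ)) (b := 1)).exists_bound_of_continuousOn
    (hh.continuous_iteratedDeriv (k + 1) (by exact_mod_cast le_top)).continuousOn
  refine ⟨M, (norm_nonneg _).trans (hM 0 (by simp)), fun n => ?_⟩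
  -- As `n` grows the order `j = k + 1 - n` falls: start from the bounded top derivative and gain
  -- one power of `|τ|` by the mean value inequality on the segment from `0` to `τ`.
  induction n with
  | zero =>
    intro j hj τ hτ
    obtain rfl : j = k + 1 := by omega
    simpa using hM τ (abs_le.1 hτ)
  | succ n ih =>
    intro j hj τ hτ
    have hd : ∀ s, HasDerivAt (iteratedDeriv j h) (iteratedDeriv (j + 1) h s) s := fun s => by
      rw [iteratedDeriv_succ]
      exact ((contDiff_iteratedDeriv (k := 1) hh (by exact_mod_cast le_top)).differentiable
        (by norm_num) s).hasDerivAt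
    have := (convex_uIcc (0 : ℝ) τ).norm_image_sub_le_of_norm_hasDerivWithin_le
      (f := iteratedDeriv j h) (C := M * |τ| ^ n) (fun s _ => (hd s).hasDerivWithinAt)
      (fun s hs => ?_) Set.left_mem_uIcc Set.right_mem_uIcc
    · rw [h0 j (by omega)] at this
      simpa [pow_succ, mul_assoc] using this
    · have hs' : |s| ≤ |τ| := by
        simpa using Set.abs_sub_left_of_mem_uIcc hs
      refine (ih (j + 1) (by omega) s (hs'.trans hτ)).trans ?_
      have hM0 : 0 ≤ M := (norm_nonneg _).trans (hM 0 (by simp))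
      gcongr

theorem jet_congr {a b : ℝ} {m : ℕ} {u v : ℝ → ℝ} (h : u = v) (hu : ContDiff ℝ m u)
    (hv : ContDiff ℝ m v) : jet a b m u hu = jet a b m v hv := by
  subst h; rfl

theorem contDiffAt_of_fin {m : ℕ} {u : ℝ → ℝ} (hu : ContDiff ℝ m u) (j : Fin (m + 1)) (t : ℝ) :
    ContDiffAt ℝ (j : ℕ) u t :=
  (hu.of_le (by exact_mod_cast Nat.lt_succ_iff.1 j.2)).contDiffAt

theorem jet_add {a b : ℝ} {m : ℕ} {u v : ℝ → ℝ} (hu : ContDiff ℝ m u) (hv : ContDiff ℝ m v) :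
    jet a b m (fun t => u t + v t) (hu.add hv) = jet a b m u hu + jet a b m v hv := by
  ext j t
  simp only [jet_apply, Pi.add_apply, ContinuousMap.add_apply]
  exact iteratedDeriv_fun_add (contDiffAt_of_fin hu j t) (contDiffAt_of_fin hv j t)

theorem jet_const_mul {a b : ℝ} {m : ℕ} {u : ℝ → ℝ} (c : ℝ) (hu : ContDiff ℝ m u) :
    jet a b m (fun t => c * u t) (contDiff_const.mul hu) = c • jet a b m u hu := by
  ext j t
  simp only [jet_apply, Pi.smul_apply, ContinuousMap.smul_apply, smul_eq_mul]
  exact iteratedDeriv_const_mul_field c u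

theorem jet_sum {a b : ℝ} {m : ℕ} {ι : Type*} (s : Finset ι) {u : ι → ℝ → ℝ}
    (hu : ∀ i, ContDiff ℝ m (u i)) :
    jet a b m (fun t => ∑ i ∈ s, u i t) (ContDiff.sum fun i _ => hu i) =
      ∑ i ∈ s, jet a b m (u i) (hu i) := by
  ext j t
  simp only [jet_apply, Finset.sum_apply, ContinuousMap.coe_sum]
  exact iteratedDeriv_fun_sum fun i _ => contDiffAt_of_fin (hu i) j t

/-- The `j`-th derivative is `w ^ j` times `iteratedDeriv j h (w t)`. For `j ≤ k` flatness supplies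
the missing `|w| ^ (k + 1 - j)`; for `j > k` the factor `w ^ j` alone is small enough. Dividing by
`w ^ k` leaves `O(|w|)`. -/
theorem tendsto_jet_dilate_flat (a b : ℝ) (m : ℕ) {h : ℝ → ℝ} (hh : ContDiff ℝ ∞ h) {k : ℕ}
    (h0 : ∀ i ≤ k, iteratedDeriv i h 0 = 0) (hm : ContDiff ℝ m h) :
    Tendsto (fun w : ℝ => (w ^ k)⁻¹ • jet a b m (fun t => h (w * t + 0)) (contDiff_ridge hm w 0))
      (𝓝[≠] 0) (𝓝 0) := by
  obtain ⟨M, hM0, hM⟩ := exists_bound_of_flat hh h0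
  obtain ⟨R, hR1, hR⟩ : ∃ R : ℝ, 1 ≤ R ∧ ∀ t : Set.Icc a b, |(t : ℝ)| ≤ R :=
    ⟨max 1 (max |a| |b|), le_max_left _ _, fun t =>
      (abs_le_max_abs_abs t.2.1 t.2.2).trans (le_max_right _ _)⟩
  rw [tendsto_pi_nhds]
  intro j
  have hj : (j : ℕ) ≤ m := Nat.lt_succ_iff.1 j.2
  obtain ⟨B, hB⟩ := (isCompact_Icc (a := (-1 : ℝ)) (b := 1)).exists_bound_of_continuousOn
    (hh.continuous_iteratedDeriv j (by exact_mod_cast le_top)).continuousOn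
  have hB0 : 0 ≤ B := (norm_nonneg _).trans (hB 0 (by simp))
  set C := max B (M * R ^ (k + 1)) with hC
  have hC0 : 0 ≤ C := hB0.trans (le_max_left _ _)
  have hsmall : ∀ᶠ w : ℝ in 𝓝[≠] 0, |w| * R ≤ 1 ∧ |w| ≤ 1 ∧ w ≠ 0 := by
    have h1 : Tendsto (fun w : ℝ => |w| * R) (𝓝 0) (𝓝 0) := by
      have : Continuous fun w : ℝ => |w| * R := by fun_prop
      simpa using this.tendsto 0
    have h2 := (h1.eventually (eventually_le_nhds zero_lt_one))
    filter_upwards [nhdsWithin_le_nhds h2, self_mem_nhdsWithin] with w hw hw0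
    exact ⟨hw, (le_mul_of_one_le_right (abs_nonneg _) hR1).trans hw, hw0⟩
  refine squeeze_zero_norm' (a := fun w : ℝ => C * |w|) ?_ ?_
  · filter_upwards [hsmall] with w ⟨hw, hw1, hw0⟩
    have hwp : 0 < |w| := abs_pos.2 hw0
    rw [ContinuousMap.norm_le _ (by positivity)]
    intro t
    rw [Pi.smul_apply, ContinuousMap.smul_apply, jet_apply, iteratedDeriv_ridge hj hm, add_zero,
      smul_eq_mul, Real.norm_eq_abs, abs_mul, abs_inv, abs_pow, abs_mul, abs_pow]
    have hwt : |w * t| ≤ 1 := by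
      rw [abs_mul]; exact (mul_le_mul_of_nonneg_left (hR t) hwp.le).trans hw
    rw [inv_mul_le_iff₀ (by positivity)]
    rcases le_or_gt (j : ℕ) k with hjk | hjk
    · have h1 := hM (k + 1 - j) j (by omega) (w * t) hwt
      have h2 : |w * t| ^ (k + 1 - (j : ℕ)) ≤ |w| ^ (k + 1 - (j : ℕ)) * R ^ (k + 1) := by
        rw [abs_mul, mul_pow]
        gcongr
        exact (pow_le_pow_left₀ (abs_nonneg _) (hR t) _).trans
          (pow_le_pow_right₀ hR1 (Nat.sub_le _ _))
      calc |w| ^ (j : ℕ) * |iteratedDeriv j h (w * t)|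
          ≤ |w| ^ (j : ℕ) * (M * (|w| ^ (k + 1 - (j : ℕ)) * R ^ (k + 1))) := by
            gcongr; exact h1.trans (mul_le_mul_of_nonneg_left h2 hM0)
        _ = (|w| ^ (j : ℕ) * |w| ^ (k + 1 - (j : ℕ))) * (M * R ^ (k + 1)) := by ring
        _ = |w| ^ k * (M * R ^ (k + 1) * |w|) := by
            rw [← pow_add, Nat.add_sub_cancel' (by omega)]; ring
        _ ≤ _ := by gcongr; exact le_max_right _ _
    · have h1 : |iteratedDeriv j h (w * t)| ≤ B := hB (w * t) (abs_le.1 hwt)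
      have h2 : |w| ^ (j : ℕ) ≤ |w| ^ (k + 1) := pow_le_pow_of_le_one hwp.le hw1 hjk
      calc _ ≤ |w| ^ (k + 1) * C := by
            gcongr; exact h1.trans (le_max_left _ _)
        _ = _ := by ring
  · have : Continuous fun w : ℝ => C * |w| := by fun_prop
    simpa using (this.tendsto 0).mono_left nhdsWithin_le_nhds

/-- Write `g (w t + c) = ∑ A i w^i t^i + h (w t)` with `i ≤ k` and `h` flat to order `k`. Subtract
the terms `i < k`, which are in the closed span by strong induction, and divide by `w ^ k`: the
limit as `w → 0` is `A k t^k`, and `A k ≠ 0`. -/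
theorem jet_pow_mem (a b : ℝ) {m : ℕ} {σ : ℝ → ℝ} (hσ : ContDiff ℝ m σ)
    (hpoly : ¬ ∃ P : Polynomial ℝ, ∀ t : ℝ, σ t = P.eval t) (k : ℕ) :
    jet a b m (fun t => t ^ k) (contDiff_id.pow k) ∈ ridgeClosure a b m σ hσ := by
  induction k using Nat.strong_induction_on with
  | _ k ih =>
  obtain ⟨ψ, hψ, hψc, c, hc⟩ := exists_iteratedDeriv_mollify_ne_zero hσ.continuous hpoly k
  set g := mollify ψ σ
  have hg : ContDiff ℝ ∞ g := contDiff_mollify hψ hψc hσ.continuous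
  have hgm : ContDiff ℝ m g := hg.of_le (by exact_mod_cast le_top)
  set A : ℕ → ℝ := fun i => iteratedDeriv i g c / i.factorial with hA
  set h : ℝ → ℝ := fun τ => g (τ + c) - ∑ i ∈ Finset.range (k + 1), A i * τ ^ i with hdef
  have hp : ∀ n : WithTop ℕ∞, ContDiff ℝ n fun τ : ℝ => ∑ i ∈ Finset.range (k + 1), A i * τ ^ i :=
    fun n => ContDiff.sum fun i _ => contDiff_const.mul (contDiff_id.pow i)
  have hgc : ContDiff ℝ ∞ fun τ => g (τ + c) := hg.comp (contDiff_id.add contDiff_const)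
  have hh : ContDiff ℝ ∞ h := hgc.sub (hp _)
  have hm : ContDiff ℝ m h := hh.of_le (by exact_mod_cast le_top)
  have h0 : ∀ i ≤ k, iteratedDeriv i h 0 = 0 := by
    intro i hi
    rw [hdef, iteratedDeriv_fun_sub (hgc.of_le (by exact_mod_cast le_top)).contDiffAt
      (hp _).contDiffAt, iteratedDeriv_fun_sum fun l _ =>
        (contDiff_const.mul (contDiff_id.pow l)).contDiffAt, iteratedDeriv_comp_add_const]
    simp only [iteratedDeriv_const_mul_field, iteratedDeriv_fun_pow_zero]
    rw [Finset.sum_eq_single i]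
    · have : (i.factorial : ℝ) ≠ 0 := by positivity
      simp [hA, this]
    · intro l _ hl; simp [Ne.symm hl]
    · intro hi'; exact absurd (Finset.mem_range.2 (by omega)) hi'
  have hAk : A k ≠ 0 := div_ne_zero hc (by positivity)
  have hdecomp : ∀ w : ℝ, jet a b m (fun t => g (w * t + c)) (contDiff_ridge hgm w c) =
      jet a b m (fun t => h (w * t + 0)) (contDiff_ridge hm w 0) +
        ∑ i ∈ Finset.range (k + 1), (A i * w ^ i) • jet a b m (fun t => t ^ i)
          (contDiff_id.pow i) := by
    intro w
    simp only [← jet_const_mul]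
    rw [← jet_sum (Finset.range (k + 1)) (u := fun i t => A i * w ^ i * t ^ i)
      (fun i => contDiff_const.mul (contDiff_id.pow i)), ← jet_add]
    refine jet_congr (funext fun t => ?_) _ _
    simp [hdef, mul_pow, mul_assoc]
  have hlim := (tendsto_jet_dilate_flat a b m hh h0 hm).add_const
    (A k • jet a b m (fun t => t ^ k) (contDiff_id.pow k))
  rw [zero_add] at hlim
  have hmem := (isClosed_ridgeClosure a b m σ hσ).mem_of_tendsto hlim ?_
  · have := Submodule.smul_mem _ (A k)⁻¹ hmem
    rwa [smul_smul, inv_mul_cancel₀ hAk, one_smul] at this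
  · filter_upwards [self_mem_nhdsWithin] with w hw
    have hwk : w ^ k ≠ 0 := pow_ne_zero _ hw
    have h1 : (w ^ k)⁻¹ • jet a b m (fun t => h (w * t + 0)) (contDiff_ridge hm w 0) +
        A k • jet a b m (fun t => t ^ k) (contDiff_id.pow k) =
        (w ^ k)⁻¹ • (jet a b m (fun t => g (w * t + c)) (contDiff_ridge hgm w c) -
          ∑ i ∈ Finset.range k, (A i * w ^ i) • jet a b m (fun t => t ^ i)
          (contDiff_id.pow i)) := by
      rw [hdecomp w, Finset.sum_range_succ, add_sub_assoc, add_sub_cancel_left, smul_add,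
        smul_smul]
      congr 2
      field_simp
    rw [h1]
    exact Submodule.smul_mem _ _ (Submodule.sub_mem _ (jet_mollify_ridge_mem a b hσ hψ hψc hgm w c)
      (Submodule.sum_mem _ fun i hi => Submodule.smul_mem _ _ (ih i (Finset.mem_range.1 hi))))

/-! ### Polynomials and their density among `C^m` functions. -/

theorem contDiff_polynomial_eval {n : WithTop ℕ∞} (P : Polynomial ℝ) :
    ContDiff ℝ n fun t => P.eval t := by
  simpa using P.contDiff_aeval (𝕜 := ℝ) n

theorem jet_polynomial_mem (a b : ℝ) {m : ℕ} {σ : ℝ → ℝ} (hσ : ContDiff ℝ m σ)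
    (hpoly : ¬ ∃ P : Polynomial ℝ, ∀ t : ℝ, σ t = P.eval t) (P : Polynomial ℝ) :
    jet a b m (fun t => P.eval t) (contDiff_polynomial_eval P) ∈ ridgeClosure a b m σ hσ := by
  have h : (fun t => P.eval t) = fun t => ∑ i ∈ Finset.range (P.natDegree + 1),
      P.coeff i * t ^ i := funext fun t => P.eval_eq_sum_range t
  rw [jet_congr h _ (ContDiff.sum fun i _ => contDiff_const.mul (contDiff_id.pow i)),
    jet_sum _ (u := fun i t => P.coeff i * t ^ i)
      (fun i => contDiff_const.mul (contDiff_id.pow i))]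
  refine Submodule.sum_mem _ fun i _ => ?_
  rw [jet_const_mul (u := fun t => t ^ i) _ (contDiff_id.pow i)]
  exact Submodule.smul_mem _ _ (jet_pow_mem a b hσ hpoly i)

theorem exists_polynomial_derivative_eq (q : Polynomial ℝ) :
    ∃ Q : Polynomial ℝ, Polynomial.derivative Q = q := by
  induction q using Polynomial.induction_on' with
  | add p q hp hq =>
    obtain ⟨P, rfl⟩ := hp
    obtain ⟨Q, rfl⟩ := hq
    exact ⟨P + Q, Polynomial.derivative_add⟩
  | monomial n c =>
    refine ⟨Polynomial.monomial (n + 1) (c / (n + 1)), ?_⟩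
    rw [Polynomial.derivative_monomial]
    have : (n : ℝ) + 1 ≠ 0 := by positivity
    simp [this]

/-- Simultaneous Weierstrass approximation of a `C^m` function and its derivatives. -/
theorem exists_polynomial_iteratedDeriv_near {a b : ℝ} (hab : a ≤ b) (m : ℕ) {v : ℝ → ℝ}
    (hv : ContDiff ℝ m v) {ε : ℝ} (hε : 0 < ε) :
    ∃ P : Polynomial ℝ, ∀ j ≤ m, ∀ t ∈ Set.Icc a b,
      |iteratedDeriv j (fun t => P.eval t) t - iteratedDeriv j v t| < ε := by
  induction m generalizing v ε with
  | zero =>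
    obtain ⟨P, hP⟩ := exists_polynomial_near_of_continuousOn a b v hv.continuous.continuousOn ε hε
    refine ⟨P, fun j hj t ht => ?_⟩
    obtain rfl : j = 0 := by omega
    simpa using hP t ht
  | succ m ih =>
    have hv' : ContDiff ℝ m (deriv v) := by
      rw [← iteratedDeriv_one]; exact contDiff_iteratedDeriv hv le_rfl
    -- Integrating an error `δ` over `[a, b]` costs a factor `b - a`; the `+ 1` makes the bound
    -- strict and covers `a = b`.
    set δ := ε / (b - a + 1) with hδ
    have hba : 0 < b - a + 1 := by linarith
    have hδ0 : 0 < δ := by positivity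
    obtain ⟨q, hq⟩ := ih hv' (lt_min hε hδ0)
    obtain ⟨Q₀, hQ₀⟩ := exists_polynomial_derivative_eq q
    -- The constant of integration makes `Q` and `v` agree at `a`.
    set Q := Q₀ + Polynomial.C (v a - Q₀.eval a) with hQ
    have hQd : deriv (fun t => Q.eval t) = fun t => q.eval t := by
      ext t; rw [Polynomial.deriv, hQ]; simp [hQ₀]
    refine ⟨Q, fun j hj t ht => ?_⟩
    rcases j with _ | j
    · have hd : ∀ s ∈ Set.Icc a b, HasDerivWithinAt (fun t => Q.eval t - v t)
          (q.eval s - deriv v s) (Set.Icc a b) s := fun s _ => by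
        refine HasDerivAt.hasDerivWithinAt (HasDerivAt.sub ?_ ?_)
        · rw [← congrFun hQd s]; exact Q.differentiable.differentiableAt.hasDerivAt
        · exact ((hv.of_le (m := 1) (by exact_mod_cast (by omega : 1 ≤ m + 1))).differentiable
            (by norm_num) s).hasDerivAt
      have := (convex_Icc a b).norm_image_sub_le_of_norm_hasDerivWithin_le hd (C := δ)
        (fun s hs => by simpa using ((hq 0 (Nat.zero_le _) s hs).trans_le (min_le_right _ _)).le)
        (Set.left_mem_Icc.2 hab) ht
      have ha : Q.eval a - v a = 0 := by simp [hQ]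
      rw [ha, sub_zero, Real.norm_eq_abs, Real.norm_eq_abs, abs_of_nonneg (sub_nonneg.2 ht.1)]
        at this
      simp only [iteratedDeriv_zero]
      refine this.trans_lt ?_
      calc δ * (t - a) < δ * (b - a + 1) := by
            refine mul_lt_mul_of_pos_left ?_ hδ0; linarith [ht.2]
        _ = ε := by rw [hδ]; field_simp
    · rw [iteratedDeriv_succ', iteratedDeriv_succ', hQd]
      exact (hq j (by omega) t ht).trans_le (min_le_left _ _)

theorem jet_mem_ridgeClosure {a b : ℝ} (hab : a ≤ b) {m : ℕ} {σ : ℝ → ℝ} (hσ : ContDiff ℝ m σ)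
    (hpoly : ¬ ∃ P : Polynomial ℝ, ∀ t : ℝ, σ t = P.eval t) {v : ℝ → ℝ} (hv : ContDiff ℝ m v) :
    jet a b m v hv ∈ ridgeClosure a b m σ hσ := by
  rw [← SetLike.mem_coe, ← (isClosed_ridgeClosure a b m σ hσ).closure_eq, Metric.mem_closure_iff]
  intro ε hε
  obtain ⟨P, hP⟩ := exists_polynomial_iteratedDeriv_near hab m hv (half_pos hε)
  refine ⟨_, jet_polynomial_mem a b hσ hpoly P, ?_⟩
  refine lt_of_le_of_lt ?_ (half_lt_self hε)
  rw [dist_pi_le_iff (half_pos hε).le]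
  intro j
  rw [ContinuousMap.dist_le (half_pos hε).le]
  intro t
  rw [dist_comm, Real.dist_eq]
  exact (hP j (Nat.lt_succ_iff.1 j.2) t t.2).le

/-! ### Calculus of products of one-variable functions -/

/-- The function `x ↦ ∏ i, v i (x i)`. -/
def tensorProd {d : ℕ} (v : Fin d → ℝ → ℝ) (x : Fin d → ℝ) : ℝ := ∏ i, v i (x i)

variable {d : ℕ}

theorem continuous_tensorProd {v : Fin d → ℝ → ℝ} (hv : ∀ i, Continuous (v i)) :
    Continuous (tensorProd v) :=
  continuous_finsetProd _ fun i _ => (hv i).comp (continuous_apply i)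

theorem contDiff_tensorProd {n : WithTop ℕ∞} {v : Fin d → ℝ → ℝ} (hv : ∀ i, ContDiff ℝ n (v i)) :
    ContDiff ℝ n (tensorProd v) :=
  contDiff_prod fun i _ => (hv i).comp (contDiff_apply ℝ ℝ i)

theorem partialDeriv_tensorProd {v : Fin d → ℝ → ℝ} (hv : ∀ i, Differentiable ℝ (v i))
    (k : Fin d) :
    partialDeriv k (tensorProd v) = tensorProd (Function.update v k (deriv (v k))) := by
  ext x
  have h1 : ∀ i ∈ Finset.univ, HasFDerivAt (fun x : Fin d → ℝ => v i (x i))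
      (deriv (v i) (x i) • ContinuousLinearMap.proj (R := ℝ) (φ := fun _ : Fin d => ℝ) i) x :=
    fun i _ => (hv i (x i)).hasDerivAt.comp_hasFDerivAt x (hasFDerivAt_apply i x)
  have h2 := HasFDerivAt.finsetProd h1
  unfold partialDeriv tensorProd
  rw [h2.fderiv]
  simp only [sum_apply, smul_apply,
    ContinuousLinearMap.proj_apply, smul_eq_mul]
  rw [Finset.sum_eq_single k]
  · rw [← Finset.mul_prod_erase _ _ (Finset.mem_univ k)]
    simp only [Function.update_self, Pi.single_eq_same, mul_one]
    rw [mul_comm]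
    congr 1
    refine Finset.prod_congr rfl fun i hi => ?_
    rw [Function.update_of_ne (Finset.ne_of_mem_erase hi)]
  · intro i _ hi; simp [hi]
  · simp

theorem contDiff_update {n : WithTop ℕ∞} {v : Fin d → ℝ → ℝ} (hv : ∀ i, ContDiff ℝ n (v i))
    {k : Fin d} {u : ℝ → ℝ} (hu : ContDiff ℝ n u) (i : Fin d) :
    ContDiff ℝ n (Function.update v k u i) := by
  rcases eq_or_ne i k with rfl | h
  · simpa using hu
  · simpa [h] using hv i

theorem iterate_partialDeriv_tensorProd {v : Fin d → ℝ → ℝ} (hv : ∀ i, ContDiff ℝ ∞ (v i))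
    (k : Fin d) (n : ℕ) :
    (partialDeriv k)^[n] (tensorProd v) =
      tensorProd (Function.update v k (iteratedDeriv n (v k))) := by
  induction n with
  | zero => simp
  | succ n ih =>
    have hs : ContDiff ℝ ∞ (iteratedDeriv n (v k)) := by
      rw [iteratedDeriv_eq_iterate]; exact (hv k).iterate_deriv n
    rw [Function.iterate_succ_apply', ih, partialDeriv_tensorProd, iteratedDeriv_succ]
    · simp
    · exact fun i => (contDiff_update hv hs i).differentiable (by simp)

theorem foldr_partialDeriv_tensorProd {v : Fin d → ℝ → ℝ} (hv : ∀ i, ContDiff ℝ ∞ (v i))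
    (α : Fin d → ℕ) (l : List (Fin d)) (hl : l.Nodup) :
    l.foldr (fun i ψ => (partialDeriv i)^[α i] ψ) (tensorProd v) =
      tensorProd fun i => if i ∈ l then iteratedDeriv (α i) (v i) else v i := by
  induction l with
  | nil => simp
  | cons k l ih =>
    obtain ⟨hk, hl'⟩ := List.nodup_cons.1 hl
    rw [List.foldr_cons, ih hl', iterate_partialDeriv_tensorProd]
    · congr 1
      ext i : 1
      rcases eq_or_ne i k with rfl | h
      · simp [hk]
      · simp [h]
    · intro i
      split_ifs
      · rw [iteratedDeriv_eq_iterate]; exact (hv i).iterate_deriv _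
      · exact hv i

theorem multiDeriv_tensorProd {v : Fin d → ℝ → ℝ} (hv : ∀ i, ContDiff ℝ ∞ (v i))
    (α : Fin d → ℕ) :
    multiDeriv α (tensorProd v) = tensorProd fun i => iteratedDeriv (α i) (v i) := by
  simp [multiDeriv, foldr_partialDeriv_tensorProd hv α _ (List.nodup_finRange d)]

theorem IsTestFunction.partialDeriv {U : Set (Fin d → ℝ)} {φ : (Fin d → ℝ) → ℝ}
    (h : IsTestFunction U φ) (k : Fin d) : IsTestFunction U (partialDeriv k φ) := by
  refine ⟨?_, ?_, ?_⟩
  · exact (h.1.fderiv_right (m := ∞) (by simp)).clm_apply contDiff_const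
  · exact h.2.1.fderiv_apply ℝ _
  · exact (tsupport_fderiv_apply_subset ℝ _).trans h.2.2

theorem IsTestFunction.iterate_partialDeriv {U : Set (Fin d → ℝ)} {φ : (Fin d → ℝ) → ℝ}
    (h : IsTestFunction U φ) (k : Fin d) (n : ℕ) :
    IsTestFunction U ((TensorNN.partialDeriv k)^[n] φ) := by
  induction n with
  | zero => exact h
  | succ n ih => rw [Function.iterate_succ_apply']; exact ih.partialDeriv k

theorem IsTestFunction.foldr_partialDeriv {U : Set (Fin d → ℝ)} {φ : (Fin d → ℝ) → ℝ}
    (h : IsTestFunction U φ) (α : Fin d → ℕ) (l : List (Fin d)) :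
    IsTestFunction U (l.foldr (fun i ψ => (TensorNN.partialDeriv i)^[α i] ψ) φ) := by
  induction l with
  | nil => exact h
  | cons k l ih => exact ih.iterate_partialDeriv k (α k)

theorem IsTestFunction.multiDeriv {U : Set (Fin d → ℝ)} {φ : (Fin d → ℝ) → ℝ}
    (h : IsTestFunction U φ) (α : Fin d → ℕ) : IsTestFunction U (multiDeriv α φ) :=
  h.foldr_partialDeriv α _

theorem integral_tensorProd_mul_partialDeriv {U : Set (Fin d → ℝ)} {v : Fin d → ℝ → ℝ}
    (hv : ∀ i, ContDiff ℝ 1 (v i)) {φ : (Fin d → ℝ) → ℝ} (hφ : IsTestFunction U φ) (k : Fin d) :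
    ∫ x, tensorProd v x * partialDeriv k φ x =
      -∫ x, tensorProd (Function.update v k (deriv (v k))) x * φ x := by
  have hd : ∀ i, Differentiable ℝ (v i) := fun i => (hv i).differentiable (by norm_num)
  have hc : Continuous (tensorProd v) := continuous_tensorProd fun i => (hv i).continuous
  have hc' : Continuous (partialDeriv k (tensorProd v)) := by
    rw [partialDeriv_tensorProd hd]
    refine continuous_tensorProd fun i => ?_
    rcases eq_or_ne i k with rfl | h
    · simpa using (hv i).continuous_deriv le_rfl
    · simpa [h] using (hv i).continuous
  have hφk := hφ.partialDeriv k
  rw [← partialDeriv_tensorProd hd]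
  exact integral_mul_fderiv_eq_neg_fderiv_mul_of_integrable
    ((hc'.mul hφ.1.continuous).integrable_of_hasCompactSupport hφ.2.1.mul_left)
    ((hc.mul hφk.1.continuous).integrable_of_hasCompactSupport hφk.2.1.mul_left)
    ((hc.mul hφ.1.continuous).integrable_of_hasCompactSupport hφ.2.1.mul_left)
    (fun x _ => (contDiff_tensorProd hv).differentiable (by norm_num) x)
    (fun x _ => hφ.1.differentiable (by simp) x)

theorem integral_tensorProd_mul_iterate_partialDeriv {U : Set (Fin d → ℝ)} {n : ℕ}
    {v : Fin d → ℝ → ℝ} (hv : ∀ i, ContDiff ℝ n (v i)) {φ : (Fin d → ℝ) → ℝ}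
    (hφ : IsTestFunction U φ) (k : Fin d) :
    ∫ x, tensorProd v x * (partialDeriv k)^[n] φ x =
      (-1) ^ n * ∫ x, tensorProd (Function.update v k (iteratedDeriv n (v k))) x * φ x := by
  induction n generalizing φ with
  | zero => simp
  | succ n ih =>
    have hle : ((n : ℕ) : WithTop ℕ∞) ≤ (n + 1 : ℕ) := by exact_mod_cast Nat.le_succ n
    have hle1 : (1 : WithTop ℕ∞) ≤ (n + 1 : ℕ) := by exact_mod_cast (by omega : 1 ≤ n + 1)
    have hs : ContDiff ℝ (1 : ℕ) (iteratedDeriv n (v k)) :=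
      contDiff_iteratedDeriv (hv k) (by rw [add_comm])
    rw [Function.iterate_succ_apply, ih (fun i => (hv i).of_le hle) (hφ.partialDeriv k),
      integral_tensorProd_mul_partialDeriv
        (fun i => contDiff_update (fun i => (hv i).of_le hle1) hs i) hφ, iteratedDeriv_succ]
    simp [pow_succ]

/-- Integration by parts coordinate by coordinate. After treating `k`, all factors are only known to
be `C^(n - α k)`, which still covers the orders left in the list; hence the bound on the sum and the
generalization over `n` and `v`. -/
theorem integral_tensorProd_mul_foldr {U : Set (Fin d → ℝ)} (α : Fin d → ℕ) (l : List (Fin d))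
    (hl : l.Nodup) {n : ℕ} (hn : (l.map α).sum ≤ n) {v : Fin d → ℝ → ℝ}
    (hv : ∀ i, ContDiff ℝ n (v i)) {φ : (Fin d → ℝ) → ℝ} (hφ : IsTestFunction U φ) :
    ∫ x, tensorProd v x * l.foldr (fun i ψ => (partialDeriv i)^[α i] ψ) φ x =
      (-1) ^ (l.map α).sum *
        ∫ x, tensorProd (fun i => if i ∈ l then iteratedDeriv (α i) (v i) else v i) x * φ x := by
  induction l generalizing n v with
  | nil => simp
  | cons k l ih =>
    obtain ⟨hk, hl'⟩ := List.nodup_cons.1 hl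
    rw [List.map_cons, List.sum_cons] at hn
    have hle : ∀ p ≤ n, ((p : ℕ) : WithTop ℕ∞) ≤ n := fun p hp => by exact_mod_cast hp
    rw [List.foldr_cons, integral_tensorProd_mul_iterate_partialDeriv
      (fun i => (hv i).of_le (hle (α k) (by omega))) (hφ.foldr_partialDeriv α l),
      ih hl' (n := n - α k) (by omega), List.map_cons, List.sum_cons, pow_add, mul_assoc]
    · congr 4
      ext x
      congr 2
      ext i : 1
      rcases eq_or_ne i k with rfl | h
      · simp [hk]
      · simp [h]
    · refine contDiff_update (fun i => (hv i).of_le (hle _ (by omega)))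
        (contDiff_iteratedDeriv (hv k) (hle _ (by omega)))

/-! ### Weak derivatives -/

theorem IsTestFunction.integrableOn_mul {U : Set (Fin d → ℝ)} {φ f : (Fin d → ℝ) → ℝ}
    (hφ : IsTestFunction U φ) (hf : LocallyIntegrableOn f U) (hU : MeasurableSet U) :
    IntegrableOn (fun x => f x * φ x) U := by
  have h1 : IntegrableOn f (tsupport φ) := hf.integrableOn_compact_subset hφ.2.2 hφ.2.1
  have h2 : IntegrableOn (fun x => f x * φ x) (tsupport φ) :=
    h1.mul_continuousOn hφ.1.continuous.continuousOn hφ.2.1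
  refine IntegrableOn.of_forall_sdiff_eq_zero h2 hU fun x hx => ?_
  rw [image_eq_zero_of_notMem_tsupport hx.2, mul_zero]

theorem IsTestFunction.setIntegral_mul {U : Set (Fin d → ℝ)} {φ f : (Fin d → ℝ) → ℝ}
    (hφ : IsTestFunction U φ) : ∫ x in U, f x * φ x = ∫ x, f x * φ x :=
  setIntegral_eq_integral_of_forall_compl_eq_zero fun x hx => by
    rw [image_eq_zero_of_notMem_tsupport fun h => hx (hφ.2.2 h), mul_zero]

theorem isWeakDeriv_tensorProd (U : Set (Fin d → ℝ)) {m : ℕ} {α : Fin d → ℕ} (hα : ∑ i, α i ≤ m)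
    {v : Fin d → ℝ → ℝ} (hv : ∀ i, ContDiff ℝ m (v i)) :
    IsWeakDeriv U α (tensorProd v) (tensorProd fun i => iteratedDeriv (α i) (v i)) := by
  have hle : ∀ i, α i ≤ m := fun i =>
    (Finset.single_le_sum (f := α) (fun _ _ => Nat.zero_le _) (Finset.mem_univ i)).trans hα
  refine ⟨(continuous_tensorProd fun i => (hv i).continuous).locallyIntegrable.locallyIntegrableOn _,
    (continuous_tensorProd fun i => (hv i).continuous_iteratedDeriv _
      (by exact_mod_cast hle i)).locallyIntegrable.locallyIntegrableOn _, fun φ hφ => ?_⟩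
  have hsum : ((List.finRange d).map α).sum = ∑ i, α i := (Fin.sum_univ_def α).symm
  rw [(hφ.multiDeriv α).setIntegral_mul, hφ.setIntegral_mul]
  have := integral_tensorProd_mul_foldr α (List.finRange d) (List.nodup_finRange d)
    (hsum.trans_le hα) hv hφ
  simpa [hsum, multiDeriv] using this

theorem IsWeakDeriv.add {U : Set (Fin d → ℝ)} (hU : MeasurableSet U) {α : Fin d → ℕ}
    {f g f' g' : (Fin d → ℝ) → ℝ} (h : IsWeakDeriv U α f g) (h' : IsWeakDeriv U α f' g') :
    IsWeakDeriv U α (fun x => f x + f' x) (fun x => g x + g' x) := by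
  refine ⟨h.1.add h'.1, h.2.1.add h'.2.1, fun φ hφ => ?_⟩
  simp only [add_mul]
  rw [integral_add ((hφ.multiDeriv α).integrableOn_mul h.1 hU)
      ((hφ.multiDeriv α).integrableOn_mul h'.1 hU),
    integral_add (hφ.integrableOn_mul h.2.1 hU) (hφ.integrableOn_mul h'.2.1 hU), mul_add,
    h.2.2 φ hφ, h'.2.2 φ hφ]

theorem IsWeakDeriv.neg {U : Set (Fin d → ℝ)} {α : Fin d → ℕ} {f g : (Fin d → ℝ) → ℝ}
    (h : IsWeakDeriv U α f g) : IsWeakDeriv U α (fun x => - f x) (fun x => - g x) := by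
  refine ⟨h.1.neg, h.2.1.neg, fun φ hφ => ?_⟩
  simp only [neg_mul, integral_neg, h.2.2 φ hφ, mul_neg]

theorem isWeakDeriv_zero (U : Set (Fin d → ℝ)) (α : Fin d → ℕ) :
    IsWeakDeriv U α (fun _ => 0) (fun _ => 0) :=
  ⟨locallyIntegrableOn_zero, locallyIntegrableOn_zero, fun φ _ => by simp⟩

theorem IsWeakDeriv.sum {U : Set (Fin d → ℝ)} (hU : MeasurableSet U) {α : Fin d → ℕ}
    {ι : Type*} (s : Finset ι) {f g : ι → (Fin d → ℝ) → ℝ} (h : ∀ i, IsWeakDeriv U α (f i) (g i)) :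
    IsWeakDeriv U α (fun x => ∑ i ∈ s, f i x) (fun x => ∑ i ∈ s, g i x) := by
  classical
  induction s using Finset.induction_on with
  | empty => simpa using isWeakDeriv_zero U α
  | insert i s hi ih => simpa [Finset.sum_insert hi] using (h i).add hU ih

/-- The fundamental lemma of the calculus of variations; it makes the choice inside `weakDeriv`
harmless. -/
theorem IsWeakDeriv.ae_eq {U : Set (Fin d → ℝ)} (hU : IsOpen U) {α : Fin d → ℕ}
    {f g g' : (Fin d → ℝ) → ℝ} (h : IsWeakDeriv U α f g) (h' : IsWeakDeriv U α f g') :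
    g =ᵐ[volume.restrict U] g' := by
  have h0 := hU.ae_eq_zero_of_integral_contDiff_smul_eq_zero (μ := volume)
    (h.2.1.sub h'.2.1) fun φ h1 h2 h3 => by
      have hφ : IsTestFunction U φ := ⟨h1, h2, h3⟩
      have e := (h.2.2 φ hφ).symm.trans (h'.2.2 φ hφ)
      have e' := mul_left_cancel₀ (pow_ne_zero _ (by norm_num)) e
      simp only [Pi.sub_apply, smul_eq_mul]
      have : ∀ x, φ x * (g x - g' x) = (fun x => g x - g' x) x * φ x := fun x => mul_comm _ _
      simp only [this]
      rw [← hφ.setIntegral_mul]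
      simp only [sub_mul]
      rw [integral_sub (hφ.integrableOn_mul h.2.1 hU.measurableSet)
        (hφ.integrableOn_mul h'.2.1 hU.measurableSet), e', sub_self]
  rw [EventuallyEq, ae_restrict_iff' hU.measurableSet]
  filter_upwards [h0] with x hx hxU
  exact sub_eq_zero.1 (hx hxU)

/-- Moving the derivatives of a product kernel onto the weak derivative. -/
theorem IsWeakDeriv.integral_mul_tensorProd_iteratedDeriv {U : Set (Fin d → ℝ)} {α : Fin d → ℕ}
    {f g : (Fin d → ℝ) → ℝ} (h : IsWeakDeriv U α f g) {ψ : ℝ → ℝ} (hψ : ContDiff ℝ ∞ ψ) {δ : ℝ}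
    (hδ : 0 ≤ δ) (hψδ : ∀ s, δ < |s| → ψ s = 0) {z : Fin d → ℝ} (hz : Metric.closedBall z δ ⊆ U) :
    ∫ y in U, f y * tensorProd (fun i => iteratedDeriv (α i) ψ) (z - y) =
      ∫ y in U, g y * tensorProd (fun _ => ψ) (z - y) := by
  have hsm : ∀ i : Fin d, ContDiff ℝ ∞ fun s => ψ (z i - s) := fun i =>
    hψ.comp (contDiff_const.sub contDiff_id)
  have hzero : ∀ y ∉ Metric.closedBall z δ, tensorProd (fun i s => ψ (z i - s)) y = 0 := by
    intro y hy
    rw [mem_closedBall_iff_norm, pi_norm_le_iff_of_nonneg hδ] at hy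
    push Not at hy
    obtain ⟨i, hi⟩ := hy
    refine Finset.prod_eq_zero (Finset.mem_univ i) (hψδ _ ?_)
    rw [abs_sub_comm]; exact hi
  have htest : IsTestFunction U (tensorProd fun i s => ψ (z i - s)) := by
    refine ⟨contDiff_tensorProd hsm, HasCompactSupport.intro (isCompact_closedBall z δ) hzero,
      (closure_minimal ?_ Metric.isClosed_closedBall).trans hz⟩
    intro y hy
    by_contra hy'
    exact hy (hzero y hy')
  have key := h.2.2 _ htest
  rw [multiDeriv_tensorProd hsm] at key
  -- The sign from reflecting the kernel cancels the sign in the definition of weak derivative.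
  have e : ∀ y, tensorProd (fun i => iteratedDeriv (α i) fun s => ψ (z i - s)) y =
      (-1) ^ (∑ i, α i) * tensorProd (fun i => iteratedDeriv (α i) ψ) (z - y) := by
    intro y
    unfold tensorProd
    rw [← Finset.prod_pow_eq_pow_sum, ← Finset.prod_mul_distrib]
    refine Finset.prod_congr rfl fun i _ => ?_
    dsimp only
    rw [iteratedDeriv_comp_const_sub]
    simp
  simp only [e] at key
  have e2 : ∀ y, f y * ((-1) ^ (∑ i, α i) * tensorProd (fun i => iteratedDeriv (α i) ψ) (z - y)) =
      (-1) ^ (∑ i, α i) * (f y * tensorProd (fun i => iteratedDeriv (α i) ψ) (z - y)) :=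
    fun y => by ring
  simp only [e2, integral_const_mul] at key
  exact mul_left_cancel₀ (pow_ne_zero _ (by norm_num)) key

/-! ### Mollification combined with dilation in `L²` -/

theorem map_affine_volume {r : ℝ} (hr : r ≠ 0) (v : Fin d → ℝ) :
    Measure.map (fun x : Fin d → ℝ => r • x + v) volume =
      ENNReal.ofReal |(r ^ d)⁻¹| • (volume : Measure (Fin d → ℝ)) := by
  have h := Measure.map_addHaar_smul (volume : Measure (Fin d → ℝ)) hr
  rw [Module.finrank_fin_fun] at h
  have h1 : (fun x : Fin d → ℝ => r • x + v) = (fun x => x + v) ∘ fun x => r • x := rfl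
  rw [h1, ← Measure.map_map (by fun_prop) (by fun_prop), h, Measure.map_smul,
    map_add_right_eq_self]

/-- The change of variables gives the factor `r^(-d/2)`; the crude `2 ^ d` suffices, since only
uniformity in `r` and `v` matters. -/
theorem eLpNorm_comp_affine_le {h : (Fin d → ℝ) → ℝ} (hh : StronglyMeasurable h) {r : ℝ}
    (hr : 1 / 2 ≤ r) (v : Fin d → ℝ) :
    eLpNorm (fun x => h (r • x + v)) 2 volume ≤ 2 ^ d * eLpNorm h 2 volume := by
  have hr0 : 0 < r := by linarith
  have h1 := eLpNorm_map_measure (f := fun x : Fin d → ℝ => r • x + v) (μ := volume) (p := 2)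
    hh.aestronglyMeasurable (by fun_prop)
  change eLpNorm (h ∘ fun x : Fin d → ℝ => r • x + v) 2 volume ≤ _
  rw [← h1, map_affine_volume hr0.ne']
  refine (eLpNorm_smul_measure_le _ _ _ _).trans ?_
  rw [smul_eq_mul]
  gcongr
  have h2 : ENNReal.ofReal |(r ^ d)⁻¹| ≤ 2 ^ d := by
    rw [abs_of_pos (by positivity), ← inv_pow, ENNReal.ofReal_pow (by positivity)]
    gcongr
    rw [← ENNReal.ofReal_ofNat]
    refine ENNReal.ofReal_le_ofReal ?_
    rw [inv_le_comm₀ hr0 (by norm_num)]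
    linarith
  refine (ENNReal.rpow_le_rpow h2 (by positivity)).trans ?_
  refine (ENNReal.rpow_le_rpow_of_exponent_le (one_le_pow₀ (by norm_num)) (z := 1) ?_).trans
    (by simp)
  norm_num

/-- Continuity of the affine action on `L²`. -/
theorem eventually_eLpNorm_affine_sub_le {G : (Fin d → ℝ) → ℝ} (hG : StronglyMeasurable G)
    (hG2 : MemLp G 2 volume) {K U : Set (Fin d → ℝ)} (hK : IsCompact K) (hUK : U ⊆ K)
    (hU : MeasurableSet U) (c : Fin d → ℝ) (k : ℕ) {η : ℝ} (hη : 0 < η) :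
    ∀ᶠ p : ℝ × (Fin d → ℝ) in 𝓝 (1, 0),
      eLpNorm (fun x => p.1 ^ k * G (c + p.1 • (x - c) - p.2) - G x) 2 (volume.restrict U) ≤
        ENNReal.ofReal η := by
  -- Three-term estimate: `C` bounds the affine action on `G - g` for dilation factors between `1/2`
  -- and `2`, where `g` is continuous with compact support and close to `G`. The middle term, for
  -- `g`, is uniformly small on `K`.
  set C : ℝ := 2 ^ k * 2 ^ d with hC
  have hC0 : 0 < C := by positivity
  set κ : ℝ := η / (3 * (C + 1)) with hκ
  have hκ0 : 0 < κ := by positivity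
  obtain ⟨g, hgc, hGg, hg, hg2⟩ := hG2.exists_hasCompactSupport_eLpNorm_sub_le (by norm_num)
    (ε := ENNReal.ofReal κ) (by simpa using hκ0)
  set V : ℝ := (volume U).toReal ^ (1 / 2 : ℝ) with hV
  have hUfin : volume U < ⊤ := (measure_mono hUK).trans_lt hK.measure_lt_top
  set ζ : ℝ := η / (3 * (V + 1)) with hζ
  have hV0 : 0 ≤ V := by positivity
  have hζ0 : 0 < ζ := by positivity
  have hunif : ∀ᶠ p : ℝ × (Fin d → ℝ) in 𝓝 (1, 0), ∀ x ∈ K,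
      |p.1 ^ k * g (c + p.1 • (x - c) - p.2) - g x| < ζ := by
    refine hK.eventually_forall_of_forall_eventually fun x _ => ?_
    have hc : Continuous fun q : (ℝ × (Fin d → ℝ)) × (Fin d → ℝ) =>
        |q.1.1 ^ k * g (c + q.1.1 • (q.2 - c) - q.1.2) - g q.2| := by fun_prop
    refine (hc.tendsto ((1, 0), x)).eventually (eventually_lt_nhds ?_)
    simpa using hζ0
  have hr : ∀ᶠ p : ℝ × (Fin d → ℝ) in 𝓝 (1, 0), 1 / 2 < p.1 ∧ p.1 < 2 :=
    ((continuous_fst.tendsto ((1 : ℝ), (0 : Fin d → ℝ))).eventually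
      (lt_mem_nhds (by norm_num))).and
    ((continuous_fst.tendsto ((1 : ℝ), (0 : Fin d → ℝ))).eventually (gt_mem_nhds (by norm_num)))
  filter_upwards [hunif, hr] with p hp ⟨hp1, hp2⟩
  have hgs : StronglyMeasurable g := hg.stronglyMeasurable
  have haff : ∀ x, c + p.1 • (x - c) - p.2 = p.1 • x + (c - p.1 • c - p.2) := fun x => by
    rw [smul_sub]; abel
  have hmeas : Measurable fun x : Fin d → ℝ => c + p.1 • (x - c) - p.2 := by fun_prop
  set F₁ : (Fin d → ℝ) → ℝ := fun x => p.1 ^ k * (G - g) (c + p.1 • (x - c) - p.2)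
  set F₂ : (Fin d → ℝ) → ℝ := fun x => p.1 ^ k * g (c + p.1 • (x - c) - p.2) - g x
  set F₃ : (Fin d → ℝ) → ℝ := fun x => g x - G x
  have hdec : (fun x => p.1 ^ k * G (c + p.1 • (x - c) - p.2) - G x) = F₁ + F₂ + F₃ := by
    ext x; simp only [F₁, F₂, F₃, Pi.add_apply, Pi.sub_apply]; ring
  have m1 : StronglyMeasurable F₁ :=
    (((hG.sub hgs).comp_measurable hmeas).const_mul _)
  have m2 : StronglyMeasurable F₂ := ((hgs.comp_measurable hmeas).const_mul _).sub hgs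
  have m3 : StronglyMeasurable F₃ := hgs.sub hG
  have e1 : eLpNorm F₁ 2 (volume.restrict U) ≤ ENNReal.ofReal (η / 3) := by
    calc eLpNorm F₁ 2 (volume.restrict U) ≤ eLpNorm F₁ 2 volume :=
          eLpNorm_mono_measure _ Measure.restrict_le_self
      _ = ‖p.1 ^ k‖ₑ * eLpNorm (fun x => (G - g) (p.1 • x + (c - p.1 • c - p.2))) 2 volume := by
          simp only [F₁, haff]
          exact eLpNorm_const_smul (p.1 ^ k) _ 2 volume
      _ ≤ ENNReal.ofReal (2 ^ k) * (2 ^ d * ENNReal.ofReal κ) := by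
          gcongr
          · rw [Real.enorm_eq_ofReal_abs, abs_of_pos (by positivity)]
            gcongr
          · refine (eLpNorm_comp_affine_le (hG.sub hgs) hp1.le _).trans ?_
            gcongr
      _ = ENNReal.ofReal (C * κ) := by
          rw [hC, ENNReal.ofReal_mul (by positivity), ENNReal.ofReal_mul (by positivity),
            mul_assoc, ENNReal.ofReal_pow (p := 2) (n := d) (by norm_num), ENNReal.ofReal_ofNat]
      _ ≤ _ := by
          refine ENNReal.ofReal_le_ofReal ?_
          rw [hκ, mul_div_assoc', div_le_div_iff₀ (by positivity) (by norm_num)]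
          nlinarith
  have e2 : eLpNorm F₂ 2 (volume.restrict U) ≤ ENNReal.ofReal (η / 3) := by
    refine (eLpNorm_le_of_ae_bound (C := ζ) ?_).trans ?_
    · rw [ae_restrict_iff' hU]
      exact ae_of_all _ fun x hx => (hp x (hUK hx)).le
    · rw [Measure.restrict_apply_univ]
      have hVe : volume U ^ ((2 : ENNReal).toReal⁻¹) = ENNReal.ofReal V := by
        rw [hV, ENNReal.toReal_rpow, ENNReal.ofReal_toReal]
        · norm_num
        · exact ENNReal.rpow_ne_top_of_nonneg (by norm_num) hUfin.ne
      rw [hVe, ← ENNReal.ofReal_mul hV0]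
      refine ENNReal.ofReal_le_ofReal ?_
      rw [hζ, mul_div_assoc', div_le_div_iff₀ (by positivity) (by norm_num)]
      nlinarith
  have e3 : eLpNorm F₃ 2 (volume.restrict U) ≤ ENNReal.ofReal (η / 3) := by
    calc eLpNorm F₃ 2 (volume.restrict U) ≤ eLpNorm F₃ 2 volume :=
          eLpNorm_mono_measure _ Measure.restrict_le_self
      _ = eLpNorm (G - g) 2 volume := eLpNorm_sub_comm g G 2 volume
      _ ≤ ENNReal.ofReal κ := hGg
      _ ≤ _ := by
          refine ENNReal.ofReal_le_ofReal ?_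
          rw [hκ, div_le_div_iff₀ (by positivity) (by norm_num)]
          nlinarith
  rw [hdec]
  calc _ ≤ eLpNorm (F₁ + F₂) 2 (volume.restrict U) + eLpNorm F₃ 2 (volume.restrict U) :=
        eLpNorm_add_le (m1.add m2).aestronglyMeasurable m3.aestronglyMeasurable (by norm_num)
    _ ≤ eLpNorm F₁ 2 (volume.restrict U) + eLpNorm F₂ 2 (volume.restrict U) +
        eLpNorm F₃ 2 (volume.restrict U) := by
        gcongr
        exact eLpNorm_add_le m1.aestronglyMeasurable m2.aestronglyMeasurable (by norm_num)
    _ ≤ ENNReal.ofReal (η / 3) + ENNReal.ofReal (η / 3) + ENNReal.ofReal (η / 3) := by gcongr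
    _ = ENNReal.ofReal η := by
        rw [← ENNReal.ofReal_add (by positivity) (by positivity),
          ← ENNReal.ofReal_add (by positivity) (by positivity)]
        congr 1; ring

theorem eLpNorm_two_sq {Y : Type*} [MeasurableSpace Y] (μ : Measure Y) (u : Y → ℝ) :
    eLpNorm u 2 μ ^ 2 = ∫⁻ y, ‖u y‖ₑ ^ 2 ∂μ := by
  rw [eLpNorm_eq_lintegral_rpow_enorm_toReal (by norm_num) (by norm_num), ← ENNReal.rpow_natCast,
    ← ENNReal.rpow_mul]
  simp

/-- An average of functions of `L²` norm at most `η` has `L²` norm at most `η`. -/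
theorem eLpNorm_two_integral_le {X Z : Type*} [MeasurableSpace X] [MeasurableSpace Z]
    {μ : Measure X} [SFinite μ] {ν : Measure Z} [IsProbabilityMeasure ν] {h : X → Z → ℝ}
    (hh : StronglyMeasurable (Function.uncurry h)) {η : ENNReal}
    (hη : ∀ᵐ z ∂ν, eLpNorm (fun x => h x z) 2 μ ≤ η) :
    eLpNorm (fun x => ∫ z, h x z ∂ν) 2 μ ≤ η := by
  -- On a probability space the `L¹` norm is at most the `L²` norm; Tonelli then exchanges the
  -- integrals.
  have hx : ∀ x, ‖∫ z, h x z ∂ν‖ₑ ^ 2 ≤ ∫⁻ z, ‖h x z‖ₑ ^ 2 ∂ν := fun x => by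
    have hm : AEStronglyMeasurable (h x) ν :=
      (hh.comp_measurable measurable_prodMk_left).aestronglyMeasurable
    rw [← eLpNorm_two_sq ν (h x)]
    gcongr
    refine (enorm_integral_le_lintegral_enorm _).trans ?_
    rw [← eLpNorm_one_eq_lintegral_enorm]
    exact eLpNorm_le_eLpNorm_of_exponent_le (by norm_num) hm
  have key : eLpNorm (fun x => ∫ z, h x z ∂ν) 2 μ ^ 2 ≤ η ^ 2 := by
    rw [eLpNorm_two_sq]
    calc _ ≤ ∫⁻ x, ∫⁻ z, ‖h x z‖ₑ ^ 2 ∂ν ∂μ := lintegral_mono hx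
      _ = ∫⁻ z, ∫⁻ x, ‖h x z‖ₑ ^ 2 ∂μ ∂ν :=
          lintegral_lintegral_swap (hh.enorm.pow_const 2).aemeasurable
      _ ≤ ∫⁻ _, η ^ 2 ∂ν := by
          refine lintegral_mono_ae (hη.mono fun z hz => ?_)
          rw [← eLpNorm_two_sq μ fun x => h x z]
          gcongr
      _ = η ^ 2 := by simp
  exact (ENNReal.pow_le_pow_left_iff (by norm_num)).1 key

/-- Mollification of the dilated function converges in `L²(U)`. -/
theorem eventually_eLpNorm_mollify_dilate_sub_le {U K : Set (Fin d → ℝ)} (hK : IsCompact K)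
    (hUK : U ⊆ K) (hU : MeasurableSet U) {G : (Fin d → ℝ) → ℝ} (hG : MemLp G 2 (volume.restrict U))
    (c : Fin d → ℝ) (k : ℕ) {η : ℝ} (hη : 0 < η) :
    ∃ ρ > 0, ∀ r : ℝ, |r - 1| < ρ → ∀ δ < ρ, ∀ Ψ : (Fin d → ℝ) → ℝ, Continuous Ψ → (∀ z, 0 ≤ Ψ z) →
      ∫ z, Ψ z = 1 → (∀ z, δ < ‖z‖ → Ψ z = 0) →
      eLpNorm (fun x => r ^ k * (∫ y in U, G y * Ψ (c + r • (x - c) - y)) - G x) 2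
        (volume.restrict U) ≤ ENNReal.ofReal η := by
  -- Extension by zero of a measurable representative, so that translations act on all of `ℝ^d`.
  set G' : (Fin d → ℝ) → ℝ := U.indicator (hG.1.mk G) with hG'
  have hGG' : G =ᵐ[volume.restrict U] G' :=
    hG.1.ae_eq_mk.trans (indicator_ae_eq_restrict hU).symm
  have hs : StronglyMeasurable G' := hG.1.stronglyMeasurable_mk.indicator hU
  have h2 : MemLp G' 2 volume :=
    (memLp_indicator_iff_restrict hU).2 (hG.ae_eq hG.1.ae_eq_mk)
  have hUfin : volume U < ⊤ := (measure_mono hUK).trans_lt hK.measure_lt_top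
  have h1 : Integrable G' := by
    rw [hG', integrable_indicator_iff hU]
    have : IsFiniteMeasure (volume.restrict U) := ⟨by simpa using hUfin⟩
    exact (hG.ae_eq hG.1.ae_eq_mk).integrable (by norm_num)
  obtain ⟨ρ, hρ, H⟩ := Metric.eventually_nhds_iff.1
    (eventually_eLpNorm_affine_sub_le hs h2 hK hUK hU c k hη)
  refine ⟨ρ, hρ, fun r hr δ hδ Ψ hΨ hΨ0 hΨ1 hΨδ => ?_⟩
  -- Substituting `y = w - z` makes the mollification a `ν`-average of translates by `z` with `‖z‖ ≤
  -- δ`, each already close to `G'`.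
  set ν : Measure (Fin d → ℝ) := volume.withDensity fun z => ENNReal.ofReal (Ψ z) with hν
  have hΨi : Integrable Ψ := by
    by_contra h; rw [integral_undef h] at hΨ1; norm_num at hΨ1
  have hνp : IsProbabilityMeasure ν := ⟨by
    rw [hν, withDensity_apply _ MeasurableSet.univ, Measure.restrict_univ,
      ← ofReal_integral_eq_lintegral_ofReal hΨi (ae_of_all _ hΨ0), hΨ1, ENNReal.ofReal_one]⟩
  have hνint : ∀ u : (Fin d → ℝ) → ℝ, ∫ z, u z ∂ν = ∫ z, Ψ z * u z := fun u => by
    rw [hν, integral_withDensity_eq_integral_toReal_smul (by fun_prop) (by simp)]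
    simp [ENNReal.toReal_ofReal (hΨ0 _)]
  obtain ⟨B, hB⟩ : ∃ B, ∀ z, ‖Ψ z‖ ≤ B :=
    hΨ.bounded_above_of_compact_support
      (HasCompactSupport.intro (isCompact_closedBall 0 δ) fun z hz => hΨδ z (by simpa using hz))
  have heq : ∀ x, r ^ k * (∫ y in U, G y * Ψ (c + r • (x - c) - y)) - G' x =
      ∫ z, (r ^ k * G' (c + r • (x - c) - z) - G' x) ∂ν := fun x => by
    set w := c + r • (x - c)
    have e1 : ∫ y in U, G y * Ψ (w - y) = ∫ z, Ψ z * G' (w - z) := by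
      rw [setIntegral_congr_ae₀ hU.nullMeasurableSet (g := fun y => G' y * Ψ (w - y))
        ((ae_restrict_iff' hU).1 (hGG'.mono fun y hy => by rw [hy])),
        setIntegral_eq_integral_of_forall_compl_eq_zero fun y hy => by
          rw [hG', Set.indicator_of_notMem hy, zero_mul],
        ← integral_sub_left_eq_self (fun y => G' y * Ψ (w - y)) volume w]
      simp [mul_comm]
    have hi : Integrable fun z => Ψ z * G' (w - z) :=
      (h1.comp_sub_left w).bdd_mul hΨ.aestronglyMeasurable (ae_of_all _ hB)
    rw [e1, hνint]
    simp only [mul_sub]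
    rw [integral_sub _ (hΨi.mul_const _), integral_mul_const, hΨ1, one_mul]
    · congr 1
      rw [← integral_const_mul]
      refine integral_congr_ae (ae_of_all _ fun z => ?_)
      ring
    · refine (hi.const_mul (r ^ k)).congr (ae_of_all _ fun z => ?_)
      ring
  rw [eLpNorm_congr_ae (g := fun x => ∫ z, (r ^ k * G' (c + r • (x - c) - z) - G' x) ∂ν)
    (hGG'.mono fun x hx => by dsimp only; rw [← heq x, hx])]
  refine eLpNorm_two_integral_le ?_ ?_
  · have hm1 : Measurable fun q : (Fin d → ℝ) × (Fin d → ℝ) => c + r • (q.1 - c) - q.2 := by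
      fun_prop
    exact ((hs.comp_measurable hm1).const_mul _).sub (hs.comp_measurable measurable_fst)
  · rw [hν, ae_withDensity_iff (by fun_prop)]
    refine ae_of_all _ fun z hz => H (y := (r, z)) ?_
    have hz' : ‖z‖ ≤ δ := by
      by_contra! h
      exact hz (by rw [hΨδ z h, ENNReal.ofReal_zero])
    rw [Prod.dist_eq, max_lt_iff, Real.dist_eq, dist_zero_right]
    exact ⟨hr, hz'.trans_lt hδ⟩

/-! ### Approximation by tensor products of ridge functions -/

/-- The span of the ridge functions `t ↦ σ (w t + c)`. -/
def ridgeSpan (σ : ℝ → ℝ) : Submodule ℝ (ℝ → ℝ) :=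
  Submodule.span ℝ (Set.range fun p : ℝ × ℝ => fun t => σ (p.1 * t + p.2))

theorem contDiff_of_mem_ridgeSpan {m : ℕ} {σ : ℝ → ℝ} (hσ : ContDiff ℝ m σ) {v : ℝ → ℝ}
    (hv : v ∈ ridgeSpan σ) : ContDiff ℝ m v := by
  induction hv using Submodule.span_induction with
  | mem v hv => obtain ⟨p, rfl⟩ := hv; exact contDiff_ridge hσ _ _
  | zero => exact contDiff_const
  | add u v _ _ hu hv => exact hu.add hv
  | smul c v _ hv => exact contDiff_const.smul hv

theorem ridgeClosure_le_closure (a b : ℝ) {m : ℕ} {σ : ℝ → ℝ} (hσ : ContDiff ℝ m σ) :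
    (ridgeClosure a b m σ hσ : Set (Fin (m + 1) → C(Set.Icc a b, ℝ))) ⊆
      closure {e | ∃ v, ∃ hv : v ∈ ridgeSpan σ,
        e = jet a b m v (contDiff_of_mem_ridgeSpan hσ hv)} := by
  refine closure_mono fun e he => ?_
  induction he using Submodule.span_induction with
  | mem e he =>
    obtain ⟨p, rfl⟩ := he
    exact ⟨_, Submodule.subset_span ⟨p, rfl⟩, rfl⟩
  | zero =>
    refine ⟨0, Submodule.zero_mem _, ?_⟩
    ext j t
    exact (iteratedDeriv_fun_const_zero (n := j) (x := (t : ℝ))).symm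
  | add e e' _ _ he he' =>
    obtain ⟨v, hv, rfl⟩ := he
    obtain ⟨v', hv', rfl⟩ := he'
    exact ⟨_, Submodule.add_mem _ hv hv', (jet_add _ _).symm⟩
  | smul c e _ he =>
    obtain ⟨v, hv, rfl⟩ := he
    exact ⟨_, Submodule.smul_mem _ c hv, (jet_const_mul c _).symm⟩

theorem apply_le_of_mem_multiIndices {m : ℕ} {α : Fin d → ℕ} (hα : α ∈ multiIndices d m)
    (i : Fin d) : α i ≤ m :=
  (Finset.single_le_sum (f := α) (fun _ _ => Nat.zero_le _) (Finset.mem_univ i)).trans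
    (mem_multiIndices.1 hα)

/-- The derivatives of order at most `m` of a product, in terms of those of its factors. -/
def tensorJet (a b : Fin d → ℝ) (m : ℕ)
    (e : ∀ i, Fin (m + 1) → C(Set.Icc (a i) (b i), ℝ)) :
    multiIndices d m → C(∀ i, Set.Icc (a i) (b i), ℝ) := fun α =>
  ∏ i, (e i ⟨α.1 i, Nat.lt_succ_iff.2 (apply_le_of_mem_multiIndices α.2 i)⟩).comp
    ⟨fun x => x i, continuous_apply i⟩

theorem continuous_tensorJet (a b : Fin d → ℝ) (m : ℕ) : Continuous (tensorJet a b m) :=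
  continuous_pi fun _ => continuous_finsetProd _ fun i _ =>
    (ContinuousMap.continuous_precomp _).comp ((continuous_apply _).comp (continuous_apply i))

theorem tensorJet_apply (a b : Fin d → ℝ) (m : ℕ) {v : Fin d → ℝ → ℝ}
    (hv : ∀ i, ContDiff ℝ m (v i)) (α : multiIndices d m) (x : ∀ i, Set.Icc (a i) (b i)) :
    tensorJet a b m (fun i => jet (a i) (b i) m (v i) (hv i)) α x =
      tensorProd (fun i => iteratedDeriv (α.1 i) (v i)) fun i => x i := by
  simp [tensorJet, tensorProd, ContinuousMap.prod_apply]

/-- The closed span of the derivatives of products of functions in the ridge spans. -/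
def tensorRidgeClosure (a b : Fin d → ℝ) (m : ℕ) (σ : Fin d → ℝ → ℝ)
    (hσ : ∀ i, ContDiff ℝ m (σ i)) :
    Submodule ℝ (multiIndices d m → C(∀ i, Set.Icc (a i) (b i), ℝ)) :=
  (Submodule.span ℝ {e | ∃ (v : Fin d → ℝ → ℝ) (hv : ∀ i, v i ∈ ridgeSpan (σ i)),
    e = tensorJet a b m fun i =>
      jet (a i) (b i) m (v i) (contDiff_of_mem_ridgeSpan (hσ i) (hv i))}).topologicalClosure

/-- Approximate all factors at once: the closure of a product of sets is the product of the
closures, and `tensorJet` is continuous. -/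
theorem tensorJet_mem_tensorRidgeClosure {a b : Fin d → ℝ} (hab : ∀ i, a i ≤ b i) {m : ℕ}
    {σ : Fin d → ℝ → ℝ} (hσ : ∀ i, ContDiff ℝ m (σ i))
    (hpoly : ∀ i, ¬ ∃ P : Polynomial ℝ, ∀ t : ℝ, σ i t = P.eval t) {v : Fin d → ℝ → ℝ}
    (hv : ∀ i, ContDiff ℝ m (v i)) :
    tensorJet a b m (fun i => jet (a i) (b i) m (v i) (hv i)) ∈ tensorRidgeClosure a b m σ hσ := by
  have h : (fun i => jet (a i) (b i) m (v i) (hv i)) ∈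
      closure (Set.univ.pi fun i => {e | ∃ v, ∃ hv : v ∈ ridgeSpan (σ i),
        e = jet (a i) (b i) m v (contDiff_of_mem_ridgeSpan (hσ i) hv)}) := by
    rw [closure_pi_set]
    exact fun i _ => ridgeClosure_le_closure _ _ _ (jet_mem_ridgeClosure (hab i) (hσ i) (hpoly i)
      (hv i))
  refine map_mem_closure (continuous_tensorJet a b m) h fun e he => ?_
  choose u hu heu using fun i => he i (Set.mem_univ i)
  refine Submodule.subset_span ⟨u, hu, ?_⟩
  congr 1
  exact funext heu

theorem exists_sum_tensorProd_of_mem_span (hd : 1 ≤ d) {a b : Fin d → ℝ} {m : ℕ}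
    {σ : Fin d → ℝ → ℝ} (hσ : ∀ i, ContDiff ℝ m (σ i))
    {e : multiIndices d m → C(∀ i, Set.Icc (a i) (b i), ℝ)}
    (he : e ∈ Submodule.span ℝ {e | ∃ (v : Fin d → ℝ → ℝ) (hv : ∀ i, v i ∈ ridgeSpan (σ i)),
      e = tensorJet a b m fun i =>
        jet (a i) (b i) m (v i) (contDiff_of_mem_ridgeSpan (hσ i) (hv i))}) :
    ∃ (p : ℕ) (V : Fin p → Fin d → ℝ → ℝ), (∀ j i, V j i ∈ ridgeSpan (σ i)) ∧
      ∀ α x, e α x =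
        ∑ j, tensorProd (fun i => iteratedDeriv (α.1 i) (V j i)) fun i => (x i : ℝ) := by
  induction he using Submodule.span_induction with
  | mem e he =>
    obtain ⟨v, hv, rfl⟩ := he
    exact ⟨1, fun _ => v, fun _ => hv, fun α x => by rw [tensorJet_apply]; simp⟩
  | zero => exact ⟨0, Fin.elim0, fun j => j.elim0, fun α x => by simp⟩
  | add e e' _ _ he he' =>
    obtain ⟨p, V, hV, h⟩ := he
    obtain ⟨q, W, hW, h'⟩ := he'
    refine ⟨p + q, Fin.append V W, fun j => ?_, fun α x => ?_⟩
    · refine Fin.addCases (fun j => ?_) (fun j => ?_) j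
      · simpa using hV j
      · simpa using hW j
    · rw [Fin.sum_univ_add, Pi.add_apply, ContinuousMap.add_apply, h, h']
      simp
  | smul c e _ he =>
    obtain ⟨p, V, hV, h⟩ := he
    -- A scalar is absorbed into a single factor, so some coordinate must exist.
    set i₀ : Fin d := ⟨0, hd⟩
    refine ⟨p, fun j => Function.update (V j) i₀ (c • V j i₀), fun j i => ?_, fun α x => ?_⟩
    · rcases eq_or_ne i i₀ with rfl | hi
      · simpa using Submodule.smul_mem _ c (hV j _)
      · simpa [hi] using hV j i
    · rw [Pi.smul_apply, ContinuousMap.smul_apply, h, Finset.smul_sum]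
      refine Finset.sum_congr rfl fun j _ => ?_
      unfold tensorProd
      rw [← Finset.mul_prod_erase _ _ (Finset.mem_univ i₀),
        ← Finset.mul_prod_erase _ _ (Finset.mem_univ i₀), smul_eq_mul, ← mul_assoc]
      congr 1
      · simp only [Function.update_self]
        exact (iteratedDeriv_const_mul_field c (V j i₀)).symm
      · refine Finset.prod_congr rfl fun i hi => ?_
        dsimp only
        rw [Function.update_of_ne (Finset.ne_of_mem_erase hi)]

/-- Shrinking by `r` towards the centre leaves a distance of at least `(1 - r) (b i - a i) / 2` to
the faces in direction `i`. -/
theorem closedBall_dilate_subset {a b : Fin d → ℝ} {r δ : ℝ} (hr0 : 0 ≤ r)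
    (hδ : ∀ i, δ < (1 - r) * ((b i - a i) / 2)) {x : Fin d → ℝ}
    (hx : x ∈ Set.univ.pi fun i => Set.Ioo (a i) (b i)) :
    Metric.closedBall ((fun i => (a i + b i) / 2) + r • (x - fun i => (a i + b i) / 2)) δ ⊆
      Set.univ.pi fun i => Set.Ioo (a i) (b i) := by
  intro y hy i _
  have h1 : |y i - ((a i + b i) / 2 + r * (x i - (a i + b i) / 2))| ≤ δ := by
    have := (dist_le_pi_dist y _ i).trans (Metric.mem_closedBall.1 hy)
    simpa [Real.dist_eq] using this
  obtain ⟨hx1, hx2⟩ := hx i (Set.mem_univ i)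
  have hδi := hδ i
  obtain ⟨h2, h3⟩ := abs_le.1 h1
  constructor
  · nlinarith [mul_nonneg hr0 (sub_nonneg.2 hx1.le)]
  · nlinarith [mul_nonneg hr0 (sub_nonneg.2 hx2.le)]

/-- The mollification of a dilated function `f ∈ H^m(U)` with a product kernel, together with its
derivatives, lies in the closed span of products of ridge functions. -/
theorem exists_mem_tensorRidgeClosure_eq_mollify {a b : Fin d → ℝ} (hab : ∀ i, a i ≤ b i) {m : ℕ}
    {σ : Fin d → ℝ → ℝ} (hσ : ∀ i, ContDiff ℝ m (σ i))
    (hpoly : ∀ i, ¬ ∃ P : Polynomial ℝ, ∀ t : ℝ, σ i t = P.eval t) {f : (Fin d → ℝ) → ℝ}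
    (hf : IntegrableOn f (Set.univ.pi fun i => Set.Ioo (a i) (b i)))
    {G : (Fin d → ℕ) → (Fin d → ℝ) → ℝ}
    (hG : ∀ α ∈ multiIndices d m,
      IsWeakDeriv (Set.univ.pi fun i => Set.Ioo (a i) (b i)) α f (G α))
    {r δ : ℝ} (hr0 : 0 ≤ r) (hδ0 : 0 ≤ δ) (hδ : ∀ i, δ < (1 - r) * ((b i - a i) / 2))
    {ψ : ℝ → ℝ} (hψ : ContDiff ℝ ∞ ψ) (hψδ : ∀ s, δ < |s| → ψ s = 0) :
    ∃ e ∈ tensorRidgeClosure a b m σ hσ, ∀ (α : multiIndices d m) (x : ∀ i, Set.Icc (a i) (b i)),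
      (fun i => (x i : ℝ)) ∈ (Set.univ.pi fun i => Set.Ioo (a i) (b i)) →
      e α x = r ^ (∑ i, α.1 i) * ∫ y in Set.univ.pi fun i => Set.Ioo (a i) (b i),
        G α y * tensorProd (fun _ => ψ) ((fun i => (a i + b i) / 2) +
          r • ((fun i => (x i : ℝ)) - fun i => (a i + b i) / 2) - y) := by
  set U : Set (Fin d → ℝ) := Set.univ.pi fun i => Set.Ioo (a i) (b i) with hU
  have hUm : MeasurableSet U := MeasurableSet.univ_pi fun i => measurableSet_Ioo
  have hψm : ContDiff ℝ m ψ := hψ.of_le (by exact_mod_cast le_top)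
  set κ : (Fin d → ℝ) → Fin d → ℝ := fun y i => (a i + b i) / 2 - r * ((a i + b i) / 2) - y i
  set E : (Fin d → ℝ) → multiIndices d m → C(∀ i, Set.Icc (a i) (b i), ℝ) := fun y =>
    tensorJet a b m fun i => jet (a i) (b i) m (fun t => ψ (r * t + κ y i))
      (contDiff_ridge hψm r (κ y i)) with hE
  have hEc : Continuous E := by
    refine (continuous_tensorJet a b m).comp (continuous_pi fun i => ?_)
    exact (continuous_jet_ridge (a i) (b i) hψm r).comp (by fun_prop)
  have hEmem : ∀ y, E y ∈ tensorRidgeClosure a b m σ hσ := fun y =>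
    tensorJet_mem_tensorRidgeClosure hab hσ hpoly _
  have hcpt : IsCompact (Set.univ.pi fun i => Set.Icc (a i) (b i)) :=
    isCompact_univ_pi fun i => isCompact_Icc
  obtain ⟨B, hB⟩ := hcpt.exists_bound_of_continuousOn hEc.continuousOn
  -- `E` is continuous, hence bounded on the compact closed box, so integrability of `f` is enough.
  have hint : Integrable (fun y => f y • E y) (volume.restrict U) := by
    refine Integrable.smul_bdd hf B hEc.aestronglyMeasurable ?_
    rw [ae_restrict_iff' hUm]
    exact ae_of_all _ fun y hy => hB y fun i hi => Set.Ioo_subset_Icc_self (hy i hi)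
  refine ⟨∫ y in U, f y • E y, integral_mem_submodule _ (Submodule.isClosed_topologicalClosure _)
    hint fun y => Submodule.smul_mem _ _ (hEmem y), fun α x hx => ?_⟩
  set z : Fin d → ℝ := (fun i => (a i + b i) / 2) +
    r • ((fun i => (x i : ℝ)) - fun i => (a i + b i) / 2) with hz
  have h := ((ContinuousMap.evalCLM ℝ x).comp
    (ContinuousLinearMap.proj (R := ℝ)
      (φ := fun _ : multiIndices d m => C(∀ i, Set.Icc (a i) (b i), ℝ)) α)).integral_comp_comm hint
  change ((ContinuousMap.evalCLM ℝ x).comp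
    (ContinuousLinearMap.proj (R := ℝ)
      (φ := fun _ : multiIndices d m => C(∀ i, Set.Icc (a i) (b i), ℝ)) α)) _ = _
  -- Differentiating the kernel in `x` produces `r ^ |α|` by the chain rule; the kernel's
  -- derivatives are then transferred to `G α`.
  rw [← h, ← (hG α α.2).integral_mul_tensorProd_iteratedDeriv hψ hδ0 hψδ
    (closedBall_dilate_subset hr0 hδ hx), ← integral_const_mul]
  refine integral_congr_ae (ae_of_all _ fun y => ?_)
  change f y * E y α x = _
  rw [hE]
  dsimp only
  rw [tensorJet_apply]
  unfold tensorProd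
  rw [← Finset.prod_pow_eq_pow_sum, mul_left_comm, ← Finset.prod_mul_distrib]
  congr 1
  refine Finset.prod_congr rfl fun i _ => ?_
  dsimp only
  rw [iteratedDeriv_ridge (apply_le_of_mem_multiIndices α.2 i) hψm]
  congr 2
  simp [κ]
  ring

/-- Sums of products of ridge functions are dense in `H^m` of a box. -/
theorem exists_sum_tensorProd_eLpNorm_sub_le (hd : 1 ≤ d) {a b : Fin d → ℝ} (hab : ∀ i, a i < b i)
    {m : ℕ} {σ : Fin d → ℝ → ℝ} (hσ : ∀ i, ContDiff ℝ m (σ i))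
    (hpoly : ∀ i, ¬ ∃ P : Polynomial ℝ, ∀ t : ℝ, σ i t = P.eval t) {f : (Fin d → ℝ) → ℝ}
    (hf : IntegrableOn f (Set.univ.pi fun i => Set.Ioo (a i) (b i)))
    {G : (Fin d → ℕ) → (Fin d → ℝ) → ℝ}
    (hG : ∀ α ∈ multiIndices d m,
      IsL2WeakDeriv (Set.univ.pi fun i => Set.Ioo (a i) (b i)) α f (G α))
    {κ : ℝ} (hκ : 0 < κ) :
    ∃ (p : ℕ) (V : Fin p → Fin d → ℝ → ℝ), (∀ j i, V j i ∈ ridgeSpan (σ i)) ∧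
      ∀ α ∈ multiIndices d m,
        eLpNorm (fun x => G α x - ∑ j, tensorProd (fun i => iteratedDeriv (α i) (V j i)) x) 2
          (volume.restrict (Set.univ.pi fun i => Set.Ioo (a i) (b i))) ≤ ENNReal.ofReal κ := by
  set U : Set (Fin d → ℝ) := Set.univ.pi fun i => Set.Ioo (a i) (b i) with hU
  have hUm : MeasurableSet U := MeasurableSet.univ_pi fun i => measurableSet_Ioo
  have hcpt : IsCompact (Set.univ.pi fun i => Set.Icc (a i) (b i)) :=
    isCompact_univ_pi fun i => isCompact_Icc
  have hUK : U ⊆ Set.univ.pi fun i => Set.Icc (a i) (b i) := fun x hx i hi =>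
    Set.Ioo_subset_Icc_self (hx i hi)
  have hUfin : volume U < ⊤ := (measure_mono hUK).trans_lt hcpt.measure_lt_top
  set c : Fin d → ℝ := fun i => (a i + b i) / 2 with hc
  have hκ2 : 0 < κ / 2 := half_pos hκ
  -- Phrased with a filter so that one `ρ` serves the finitely many `α`.
  have hev : ∀ᶠ ρ : ℝ in 𝓝[>] 0, ∀ α ∈ multiIndices d m, ∀ r : ℝ, |r - 1| < ρ → ∀ δ < ρ,
      ∀ Ψ : (Fin d → ℝ) → ℝ, Continuous Ψ → (∀ z, 0 ≤ Ψ z) → ∫ z, Ψ z = 1 →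
      (∀ z, δ < ‖z‖ → Ψ z = 0) →
      eLpNorm (fun x => r ^ (∑ i, α i) * (∫ y in U, G α y * Ψ (c + r • (x - c) - y)) - G α x) 2
        (volume.restrict U) ≤ ENNReal.ofReal (κ / 2) := by
    rw [eventually_all_finset]
    intro α hα
    obtain ⟨ρ, hρ, H⟩ := eventually_eLpNorm_mollify_dilate_sub_le hcpt hUK hUm (hG α hα).1 c
      (∑ i, α i) hκ2
    filter_upwards [Ioo_mem_nhdsGT hρ] with ρ' hρ' r hr δ hδ
    exact H r (hr.trans hρ'.2) δ (hδ.trans hρ'.2)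
  obtain ⟨ρ, hρH, hρ0, hρ1⟩ := (hev.and (Ioo_mem_nhdsGT (zero_lt_one (α := ℝ)))).exists
  have hsmall : ∀ᶠ δ : ℝ in 𝓝[>] 0, ∀ i, δ < ρ / 2 * ((b i - a i) / 2) := by
    rw [eventually_all]
    intro i
    have := sub_pos.2 (hab i)
    filter_upwards [Ioo_mem_nhdsGT (show 0 < ρ / 2 * ((b i - a i) / 2) by positivity)] with δ hδ
    exact hδ.2
  obtain ⟨δ, hδi, hδ0, hδρ⟩ := (hsmall.and (Ioo_mem_nhdsGT hρ0)).exists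
  -- Then `|r - 1| < ρ`, and `hδi` says that `δ` is below the margin `(1 - r) (b i - a i) / 2`.
  set r : ℝ := 1 - ρ / 2 with hr
  let β : ContDiffBump (0 : ℝ) := ⟨δ / 2, δ, half_pos hδ0, half_lt_self hδ0⟩
  set ψ : ℝ → ℝ := β.normed volume with hψdef
  have hψ : ContDiff ℝ ∞ ψ := β.contDiff_normed
  have hψδ : ∀ s, δ < |s| → ψ s = 0 := fun s hs => by
    have : s ∉ Function.support (β.normed volume) := by
      rw [β.support_normed_eq, Metric.mem_ball, dist_zero_right]
      exact not_lt.2 hs.le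
    exact Function.notMem_support.1 this
  obtain ⟨e, he, hval⟩ := exists_mem_tensorRidgeClosure_eq_mollify (fun i => (hab i).le) hσ hpoly
    hf (fun α hα => (hG α hα).2) (r := r) (δ := δ) (by linarith) hδ0.le
    (fun i => by rw [hr, sub_sub_cancel]; exact hδi i) hψ hψδ
  set W : ℝ := (volume U).toReal ^ (1 / 2 : ℝ) with hW
  have hW0 : 0 ≤ W := by positivity
  -- A uniform error `ζ` on `U` costs at most `ζ W` in `L²`, where `W` is the square root of the
  -- volume.
  set ζ : ℝ := κ / 2 / (W + 1) with hζ
  have hζ0 : 0 < ζ := by positivity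
  obtain ⟨s, hs, hes⟩ := Metric.mem_closure_iff.1 he ζ hζ0
  obtain ⟨p, V, hV, hsV⟩ := exists_sum_tensorProd_of_mem_span hd hσ hs
  refine ⟨p, V, hV, fun α hα => ?_⟩
  have hΨ := hρH α hα r (by rw [hr, abs_lt]; constructor <;> linarith) δ hδρ (tensorProd fun _ => ψ)
    (continuous_tensorProd fun _ => hψ.continuous)
    (fun z => Finset.prod_nonneg fun i _ => β.nonneg_normed _)
    (by
      have := integral_fintype_prod_volume_eq_prod (ι := Fin d) (fun _ => ψ)
      refine this.trans (Finset.prod_eq_one fun i _ => β.integral_normed))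
    (fun z hz => by
      by_contra h
      refine absurd ?_ (not_le.2 hz)
      rw [pi_norm_le_iff_of_nonneg hδ0.le]
      intro i
      by_contra! hi
      exact h (Finset.prod_eq_zero (Finset.mem_univ i) (hψδ _ hi)))
  set T : (Fin d → ℝ) → ℝ := fun x =>
    r ^ (∑ i, α i) * ∫ y in U, G α y * tensorProd (fun _ => ψ) (c + r • (x - c) - y) with hT
  set S : (Fin d → ℝ) → ℝ := fun x => ∑ j, tensorProd (fun i => iteratedDeriv (α i) (V j i)) x
  have hTS : ∀ x ∈ U, ‖T x - S x‖ ≤ ζ := by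
    intro x hx
    let x' : ∀ i, Set.Icc (a i) (b i) := fun i => ⟨x i, hUK hx i (Set.mem_univ i)⟩
    have h1 : e ⟨α, hα⟩ x' = T x := hval ⟨α, hα⟩ x' hx
    have h2 : s ⟨α, hα⟩ x' = S x := hsV ⟨α, hα⟩ x'
    rw [← h1, ← h2, ← dist_eq_norm]
    exact (ContinuousMap.dist_apply_le_dist x').trans
      ((dist_le_pi_dist e s ⟨α, hα⟩).trans hes.le)
  have hSc : Continuous S := continuous_finsetSum _ fun j _ => continuous_tensorProd fun i =>
    (contDiff_of_mem_ridgeSpan (hσ i) (hV j i)).continuous_iteratedDeriv _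
      (by exact_mod_cast apply_le_of_mem_multiIndices hα i)
  have hGm : AEStronglyMeasurable (G α) (volume.restrict U) := (hG α hα).1.1
  have hTm : AEStronglyMeasurable T (volume.restrict U) := by
    have h1 : AEStronglyMeasurable (fun q : (Fin d → ℝ) × (Fin d → ℝ) =>
        G α q.2 * tensorProd (fun _ => ψ) (c + r • (q.1 - c) - q.2))
        ((volume.restrict U).prod (volume.restrict U)) := by
      refine hGm.comp_snd.mul (Continuous.aestronglyMeasurable ?_)
      exact (continuous_tensorProd fun _ => hψ.continuous).comp (by fun_prop)
    exact h1.integral_prod_right'.const_mul _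
  have e2 : eLpNorm (T - S) 2 (volume.restrict U) ≤ ENNReal.ofReal (κ / 2) := by
    refine (eLpNorm_le_of_ae_bound (C := ζ) ?_).trans ?_
    · rw [ae_restrict_iff' hUm]
      exact ae_of_all _ hTS
    · rw [Measure.restrict_apply_univ]
      have hVe : volume U ^ ((2 : ENNReal).toReal⁻¹) = ENNReal.ofReal W := by
        rw [hW, ENNReal.toReal_rpow, ENNReal.ofReal_toReal]
        · norm_num
        · exact ENNReal.rpow_ne_top_of_nonneg (by norm_num) hUfin.ne
      rw [hVe, ← ENNReal.ofReal_mul hW0]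
      refine ENNReal.ofReal_le_ofReal ?_
      rw [hζ, mul_div_assoc', div_le_iff₀ (by positivity)]
      nlinarith
  have hdec : (fun x => G α x - S x) = -(T - G α) + (T - S) := by
    ext x; simp
  rw [hdec]
  calc _ ≤ eLpNorm (-(T - G α)) 2 (volume.restrict U) + eLpNorm (T - S) 2 (volume.restrict U) :=
        eLpNorm_add_le (hTm.sub hGm).neg (hTm.sub hSc.aestronglyMeasurable) (by norm_num)
    _ ≤ ENNReal.ofReal (κ / 2) + ENNReal.ofReal (κ / 2) := by
        rw [eLpNorm_neg]
        gcongr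
        exact hΨ
    _ = _ := by rw [← ENNReal.ofReal_add hκ2.le hκ2.le, add_halves]

/-! ### Realization by networks with one hidden layer -/

/-- All `p` outputs share one hidden layer, with a neuron for each pair `(w, c)` used by any of
them; the coefficients become the output weights. -/
theorem exists_fnn_eval_eq {σ : ℝ → ℝ} {p : ℕ} {v : Fin p → ℝ → ℝ}
    (hv : ∀ j, v j ∈ ridgeSpan σ) :
    ∃ Φ : FNN 1 p, 1 ≤ Φ.depth ∧ ∀ t j, Φ.eval σ (fun _ => t) j = v j t := by
  classical
  choose c hc using fun j => Finsupp.mem_span_range_iff_exists_finsupp.1 (hv j)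
  set T : Finset (ℝ × ℝ) := Finset.univ.biUnion fun j => (c j).support
  set q : Fin T.card → ℝ × ℝ := fun l => T.equivFin.symm l
  refine ⟨.hidden (Matrix.of fun l _ => (q l).1) (fun l => (q l).2)
    (.output (Matrix.of fun j l => c j (q l)) 0), le_rfl, fun t j => ?_⟩
  have hsub : (c j).support ⊆ T := Finset.subset_biUnion_of_mem (fun j => (c j).support)
    (Finset.mem_univ j)
  have h1 : v j t = ∑ x ∈ T, c j x * σ (x.1 * t + x.2) := by
    rw [← hc j, Finsupp.sum_of_support_subset _ hsub _ (by simp), Finset.sum_apply]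
    rfl
  rw [h1, ← Finset.sum_coe_sort, ← T.equivFin.symm.sum_comp]
  simp [FNN.eval, Matrix.mulVec, dotProduct, q]

/-! ### From `L²` bounds on the derivatives to the Sobolev norm. -/

theorem integral_sq_eq_eLpNorm {X : Type*} [MeasurableSpace X] {μ : Measure X} {u : X → ℝ}
    (hu : MemLp u 2 μ) : ∫ x, u x ^ 2 ∂μ = (eLpNorm u 2 μ).toReal ^ 2 := by
  rw [← ENNReal.toReal_pow, eLpNorm_two_sq,
    integral_eq_lintegral_of_nonneg_ae (ae_of_all _ fun x => sq_nonneg (u x))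
      (hu.1.pow 2)]
  congr 1
  refine lintegral_congr fun x => ?_
  rw [Real.enorm_eq_ofReal_abs, ← ENNReal.ofReal_pow (abs_nonneg _), sq_abs]

theorem weakDeriv_ae_eq {U : Set (Fin d → ℝ)} (hU : IsOpen U) {α : Fin d → ℕ}
    {f g : (Fin d → ℝ) → ℝ} (h : IsL2WeakDeriv U α f g) :
    weakDeriv U α f =ᵐ[volume.restrict U] g := by
  have hex : ∃ g, IsL2WeakDeriv U α f g := ⟨g, h⟩
  rw [weakDeriv, dif_pos hex]
  exact hex.choose_spec.2.ae_eq hU h.2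

theorem sobolevNorm_lt_of_forall_eLpNorm_le {m : ℕ} {U : Set (Fin d → ℝ)} (hU : IsOpen U)
    {f : (Fin d → ℝ) → ℝ} {g : (Fin d → ℕ) → (Fin d → ℝ) → ℝ}
    (hg : ∀ α ∈ multiIndices d m, IsL2WeakDeriv U α f (g α)) {ε : ℝ} (hε : 0 < ε)
    (h : ∀ α ∈ multiIndices d m, eLpNorm (g α) 2 (volume.restrict U) ≤
      ENNReal.ofReal (ε / ((multiIndices d m).card + 1))) :
    sobolevNorm m U f < ε := by
  set N : ℝ := ((multiIndices d m).card : ℝ)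
  have hN : 0 ≤ N := Nat.cast_nonneg _
  rw [sobolevNorm, Real.sqrt_lt' hε]
  have hle : ∀ α ∈ multiIndices d m, ∫ x in U, weakDeriv U α f x ^ 2 ≤ (ε / (N + 1)) ^ 2 := by
    intro α hα
    have h1 : ∫ x in U, weakDeriv U α f x ^ 2 = ∫ x in U, g α x ^ 2 :=
      integral_congr_ae ((weakDeriv_ae_eq hU (hg α hα)).mono fun x hx => by simp only [hx])
    rw [h1, integral_sq_eq_eLpNorm (hg α hα).1]
    have := ENNReal.toReal_le_of_le_ofReal (by positivity) (h α hα)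
    gcongr
  calc _ ≤ ∑ _α ∈ multiIndices d m, (ε / (N + 1)) ^ 2 := Finset.sum_le_sum hle
    _ = N * (ε / (N + 1)) ^ 2 := by rw [Finset.sum_const, nsmul_eq_mul]
    _ < ε ^ 2 := by
      rw [div_pow, mul_div_assoc', div_lt_iff₀ (by positivity)]
      nlinarith [sq_nonneg N, sq_pos_of_pos hε, mul_nonneg hN (sq_nonneg ε)]

theorem memLp_of_continuous_of_subset_compact {U K : Set (Fin d → ℝ)} (hK : IsCompact K)
    (hUK : U ⊆ K) {u : (Fin d → ℝ) → ℝ} (hu : Continuous u) :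
    MemLp u 2 (volume.restrict U) := by
  have : IsFiniteMeasure (volume.restrict K) := ⟨by simpa using hK.measure_lt_top⟩
  obtain ⟨B, hB⟩ := hK.exists_bound_of_continuousOn hu.continuousOn
  refine (MemLp.of_bound (μ := volume.restrict K) hu.aestronglyMeasurable B ?_).mono_measure
    (Measure.restrict_mono hUK le_rfl)
  rw [ae_restrict_iff' hK.measurableSet]
  exact ae_of_all _ hB

end TensorNN

end

/-! ### The main theorem. -/

theorem theorem1 (d : ℕ) (hd : 1 ≤ d) (m : ℕ)
    (a b : Fin d → ℝ) (hab : ∀ i, a i < b i)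
    (σ : Fin d → ℝ → ℝ) (hσ : ∀ i, ContDiff ℝ (m : ℕ∞) (σ i))
    (hσ_poly : ∀ i, ¬ ∃ P : Polynomial ℝ, ∀ t : ℝ, σ i t = P.eval t)
    (f : (Fin d → ℝ) → ℝ)
    (hf : TensorNN.MemSobolev m (interior (Set.univ.pi fun i => Set.Icc (a i) (b i))) f)
    (ε : ℝ) (hε : 0 < ε) :
    ∃ p : ℕ, 1 ≤ p ∧ ∃ Φ : Fin d → TensorNN.FNN 1 p,
      (∀ i, 1 ≤ (Φ i).depth) ∧
      TensorNN.MemSobolev m (interior (Set.univ.pi fun i => Set.Icc (a i) (b i)))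
        (TensorNN.tnn σ Φ) ∧
      TensorNN.sobolevNorm m (interior (Set.univ.pi fun i => Set.Icc (a i) (b i)))
        (fun x => f x - TensorNN.tnn σ Φ x) < ε := by
  open MeasureTheory TensorNN in
  have hσ' : ∀ i, ContDiff ℝ m (σ i) := fun i => by exact_mod_cast hσ i
  have hint : interior (Set.univ.pi fun i => Set.Icc (a i) (b i)) =
      Set.univ.pi fun i => Set.Ioo (a i) (b i) := by
    rw [interior_pi_set Set.finite_univ]; simp [interior_Icc]
  rw [hint] at hf ⊢
  set U : Set (Fin d → ℝ) := Set.univ.pi fun i => Set.Ioo (a i) (b i) with hU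
  have hUo : IsOpen U := isOpen_set_pi Set.finite_univ fun i _ => isOpen_Ioo
  have hcpt : IsCompact (Set.univ.pi fun i => Set.Icc (a i) (b i)) :=
    isCompact_univ_pi fun i => isCompact_Icc
  have hUK : U ⊆ Set.univ.pi fun i => Set.Icc (a i) (b i) := fun x hx i hi =>
    Set.Ioo_subset_Icc_self (hx i hi)
  have : IsFiniteMeasure (volume.restrict U) :=
    ⟨by simpa using (measure_mono hUK).trans_lt hcpt.measure_lt_top⟩
  have hfi : IntegrableOn f U := hf.1.integrable (by norm_num)
  choose! G hG using hf.2
  obtain ⟨p, V, hV, happ⟩ := exists_sum_tensorProd_eLpNorm_sub_le hd hab hσ' hσ_poly hfi hG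
    (κ := ε / ((multiIndices d m).card + 1)) (by positivity)
  -- A zero summand is added, so that there is at least one.
  have hV' : ∀ i, ∀ j : Fin (p + 1), Fin.cons (α := fun _ => Fin d → ℝ → ℝ) 0 V j i ∈
      ridgeSpan (σ i) := fun i j => by
    refine Fin.cases ?_ (fun j => ?_) j
    · exact Submodule.zero_mem _
    · simpa using hV j i
  choose Φ hdepth hΦ using fun i => exists_fnn_eval_eq (hV' i)
  have htnn : tnn σ Φ = fun x => ∑ j, tensorProd (V j) x := by
    ext x
    simp only [tnn, hΦ]
    -- The added summand is `0 ^ d`, which vanishes because `d ≥ 1`.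
    rw [Fin.sum_univ_succ]
    simp only [Fin.cons_zero, Fin.cons_succ, Pi.zero_apply, Finset.prod_const, Finset.card_univ,
      Fintype.card_fin, zero_pow (by omega : d ≠ 0), zero_add]
    rfl
  have hweak : ∀ α ∈ multiIndices d m, IsL2WeakDeriv U α (tnn σ Φ)
      fun x => ∑ j, tensorProd (fun i => iteratedDeriv (α i) (V j i)) x := by
    intro α hα
    rw [htnn]
    refine ⟨memLp_of_continuous_of_subset_compact hcpt hUK (continuous_finsetSum _ fun j _ =>
      continuous_tensorProd fun i => (contDiff_of_mem_ridgeSpan (hσ' i)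
        (hV j i)).continuous_iteratedDeriv _
          (by exact_mod_cast apply_le_of_mem_multiIndices hα i)), ?_⟩
    exact IsWeakDeriv.sum hUo.measurableSet _ fun j => isWeakDeriv_tensorProd U
      (mem_multiIndices.1 hα) fun i => contDiff_of_mem_ridgeSpan (hσ' i) (hV j i)
  refine ⟨p + 1, by omega, Φ, hdepth, ⟨?_, fun α hα => ⟨_, hweak α hα⟩⟩, ?_⟩
  · rw [htnn]
    exact memLp_of_continuous_of_subset_compact hcpt hUK (continuous_finsetSum _ fun j _ =>
      continuous_tensorProd fun i => (contDiff_of_mem_ridgeSpan (hσ' i) (hV j i)).continuous)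
  · refine sobolevNorm_lt_of_forall_eLpNorm_le hUo (fun α hα => ⟨(hG α hα).1.sub (hweak α hα).1, ?_⟩)
      hε happ
    exact (hG α hα).2.add hUo.measurableSet (hweak α hα).2.neg
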